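/- Conventions. A substitution $\tau$ on a finite alphabet $\mathcal A$ sends each letter to a non-empty word; it extends by concatenation to words and to one-sided sequences in $\mathcal A^{\mathbb N}$. It is *primitive* if for some $k\ge 1$ every letter occurs in every $\tau^k(a)$; it is *prefix-permutative* (*suffix-permutative*) if sending $a$ to the first (last) letter of $\tau(a)$ is a permutation of $\mathcal A$. Its language $\mathcal L_\tau$ is the set of subwords of the words $\tau^m(a)$, $m\ge 1$. The subshift $X_\tau\subset\mathcal A^{\mathbb N}$ is the closure of the shift orbits of the sequences fixed by some power $\tau^p$, $p\ge1$, and $\sigma$ is the one-sided shift on it; $\tau$ is *aperiodic* if $X_\tau$ contains no $\sigma$-periodic point. A point is a *$k$-branch point* if it has exactly $k$ preimages under the map considered (here $k=1$ is allowed). Two systems are topologically conjugate, $\cong$, if a homeomorphism intertwines the maps. The ordered Bratteli diagram $\mathcal B_\tau$ has one vertex at level $0$ and vertex set $\mathcal A$ at each level $m\ge 1$, exactly one edge from level $0$ to each vertex of level $1$, and, for $m\ge1$, the edges from level $m$ to the vertex $a$ of level $m+1$ are the positions of $\tau(a)$, ordered from left to right, the edge at position $i$ having as source the $i$-th letter of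 $\tau(a)$. $X_{\mathcal B_\tau}$ is the space of infinite paths starting at level $0$, with the product topology. The successor of a path that is not maximal (i.e. not all of its edges are maximal) is obtained by replacing its first non-maximal edge by the next edge with the same range, keeping all later edges, and taking minimal edges before it. An adic map $V_\tau$ is a continuous map $X_{\mathcal B_\tau}\to X_{\mathcal B_\tau}$ that sends each non-maximal path to its successor. **Theorem.** Let $\tau$ be a primitive aperiodic substitution on $\mathcal A=\{0,1,\dots,n-1\}$ that is prefix- and suffix-permutative. Then exactly $n$ sequences are fixed by some power of $\tau$, namely one sequence $x_i\in X_\tau$ beginning with $i$ for each letter $i$; if every $\tau(i)$ begins with $i$, these are exactly the fixed points of $\tau$ itself. Each $x_i$ is a $k_i$-branch point of $(X_\tau,\sigma)$ for some natural number $k_i$. Let $N$ be the number of words of length $2$ in $\mathcal L_\tau$. Then there is a primitive suffix-permutative substitution $\tau'$ on $N$ letters with the following properties. 1. $\tau'$ has exactly $n$ fixed points $v_0,\dots,v_{n-1}$ in $\{0,\dots,N-1\}^{\mathbb N}$, and each $v_i$ lies in $X_{\tau'}$ and is a $k_i$-branch point of $(X_{\tau'},\sigma)$. 2. $(X_\tau,\sigma)\cong(X_{\tau'},\sigma)$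 by a 2-block recoding: for some map $\varphi$ that restricts to a bijection from the words of length $2$ in $\mathcal L_\tau$ onto $\{0,\dots,N-1\}$, the map $\Phi(y)_m=\varphi(y_my_{m+1})$ is a homeomorphism $X_\tau\to X_{\tau'}$ that commutes with $\sigma$, and $\Phi(x_i)=v_i$ for all $i$. 3. $\mathcal B_{\tau'}$ admits an adic map $V_{\tau'}$ such that $(X_{\tau'},\sigma)\cong(X_{\mathcal B_{\tau'}},V_{\tau'})$. -/

import Mathlib

/-- A substitution on the alphabet `A`: every letter is sent to a non-empty word. -/
structure Substitution (A : Type) where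
  word : A → List A
  word_ne_nil : ∀ a, word a ≠ []

namespace Substitution

/-- Extension to words by concatenation. -/
def onWord {A : Type} (τ : Substitution A) (w : List A) : List A :=
  w.flatMap τ.word

theorem length_le_onWord {A : Type} (τ : Substitution A) (w : List A) :
    w.length ≤ (τ.onWord w).length := by
  induction w with
  | nil => simp
  | cons a w ih =>
    have h : 0 < (τ.word a).length := List.length_pos_of_ne_nil (τ.word_ne_nil a)
    simp only [onWord, List.flatMap_cons, List.length_append, List.length_cons] at ih ⊢
    omega

/-- Extension to one-sided sequences by concatenation, `τ(x) = τ(x₀) τ(x₁) ⋯`. The letter of index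
`m` is read off in the word `τ(x₀) ⋯ τ(x_m)`, which has at least `m + 1` letters. -/
def onSeq {A : Type} (τ : Substitution A) (x : ℕ → A) : ℕ → A := fun m =>
  (τ.onWord ((List.range (m + 1)).map x))[m]'(by
    have h := τ.length_le_onWord ((List.range (m + 1)).map x)
    simp only [List.length_map, List.length_range] at h
    omega)

def firstLetter {A : Type} (τ : Substitution A) (a : A) : A :=
  (τ.word a).head (τ.word_ne_nil a)

def lastLetter {A : Type} (τ : Substitution A) (a : A) : A :=
  (τ.word a).getLast (τ.word_ne_nil a)

/-- The first letters of the substitution words form a permutation of the alphabet. -/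
def PrefixPermutative {A : Type} (τ : Substitution A) : Prop :=
  Function.Bijective τ.firstLetter

/-- The last letters of the substitution words form a permutation of the alphabet. -/
def SuffixPermutative {A : Type} (τ : Substitution A) : Prop :=
  Function.Bijective τ.lastLetter

/-- For some `k ≥ 1` every letter occurs in every word `τᵏ(a)`. -/
def Primitive {A : Type} (τ : Substitution A) : Prop :=
  ∃ k : ℕ, 0 < k ∧ ∀ a b : A, b ∈ τ.onWord^[k] [a]

/-- The language of `τ`: all subwords of the words `τᵐ(a)`, `m ≥ 1`. -/
def language {A : Type} (τ : Substitution A) : Set (List A) :=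
  {w | ∃ (m : ℕ) (a : A), 0 < m ∧ w <:+: τ.onWord^[m] [a]}

/-- The one-sided sequences fixed by some power `τᵖ`, `p ≥ 1`. -/
def powerFixed {A : Type} (τ : Substitution A) : Set (ℕ → A) :=
  {u | ∃ p : ℕ, 0 < p ∧ τ.onSeq^[p] u = u}

/-- The one-sided shift map on sequences. -/
def seqShift {A : Type} (x : ℕ → A) : ℕ → A := fun m => x (m + 1)

/-- The one-sided substitution subshift: the closure of the shift orbits of the sequences fixed by
powers of `τ`. If `τ` is primitive, each single one of these orbits has the same closure. -/
def subshift {A : Type} [TopologicalSpace A] (τ : Substitution A) : Set (ℕ → A) :=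
  closure {x | ∃ u ∈ τ.powerFixed, ∃ m : ℕ, x = seqShift^[m] u}

theorem mapsTo_seqShift_subshift {A : Type} [TopologicalSpace A] (τ : Substitution A) :
    Set.MapsTo seqShift τ.subshift τ.subshift := by
  refine Set.MapsTo.closure ?_ ?_
  · rintro x ⟨u, hu, m, rfl⟩
    exact ⟨u, hu, m + 1, (Function.iterate_succ_apply' seqShift m u).symm⟩
  · exact continuous_pi fun m => continuous_apply (m + 1)

/-- The shift `σ : X_τ → X_τ`. -/
def shift {A : Type} [TopologicalSpace A] (τ : Substitution A) : τ.subshift → τ.subshift :=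
  Set.MapsTo.restrict seqShift τ.subshift τ.subshift τ.mapsTo_seqShift_subshift

/-- The subshift `X_τ` contains no shift-periodic sequence. -/
def Aperiodic {A : Type} [TopologicalSpace A] (τ : Substitution A) : Prop :=
  ∀ x ∈ τ.subshift, ∀ p : ℕ, 0 < p → seqShift^[p] x ≠ x

/-! The stationary ordered Bratteli diagram of `τ`. There is one vertex at level `0`; every level
`m ≥ 1` has the vertex set `A`. From level `0` there is exactly one edge to each vertex of level `1`.
Between consecutive levels `m ≥ 1` and `m + 1`, the edges with range `a` correspond to the letters of
`τ(a)`: the `i`-th of them, in the order of the edges with range `a`, has the `i`-th letter of `τ(a)`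
as its source. -/

/-- The edges between two consecutive levels `m ≥ 1` and `m + 1`; they carry the discrete topology. -/
abbrev Edge {A : Type} (τ : Substitution A) : Type :=
  Σ a : A, Fin (τ.word a).length

def Edge.range {A : Type} {τ : Substitution A} (e : τ.Edge) : A := e.1

def Edge.source {A : Type} {τ : Substitution A} (e : τ.Edge) : A := (τ.word e.1)[e.2]

/-- The edge is the largest among those with the same range. -/
def Edge.IsMaximal {A : Type} {τ : Substitution A} (e : τ.Edge) : Prop :=
  (e.2 : ℕ) + 1 = (τ.word e.1).length

/-- The edge is the smallest among those with the same range. -/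
def Edge.IsMinimal {A : Type} {τ : Substitution A} (e : τ.Edge) : Prop :=
  (e.2 : ℕ) = 0

/-- `f` is the successor of `e` among the edges with the same range. -/
def Edge.IsSuccessor {A : Type} {τ : Substitution A} (e f : τ.Edge) : Prop :=
  f.1 = e.1 ∧ (f.2 : ℕ) = (e.2 : ℕ) + 1

/-- The space of infinite paths from the vertex of level `0`, with the product topology. The first
component is the edge from level `0` to level `1`, which is given by its range; the second
component lists the edges from level `m + 1` to level `m + 2`, for `m = 0, 1, 2, …`. -/
def pathSpace {A : Type} (τ : Substitution A) : Set (A × (ℕ → τ.Edge)) :=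
  {p | (p.2 0).source = p.1 ∧ ∀ m : ℕ, (p.2 (m + 1)).source = (p.2 m).range}

/-- All edges of the path are maximal (the first one is, being the only edge with its range). -/
def IsMaximalPath {A : Type} {τ : Substitution A} (p : τ.pathSpace) : Prop :=
  ∀ m : ℕ, (p.1.2 m).IsMaximal

/-- `q` is the successor of the path `p`: at the first edge of `p` that is not maximal, `q` has the
successor of that edge; later edges are those of `p`, and earlier edges of `q` are minimal. -/
def IsPathSuccessor {A : Type} {τ : Substitution A} (p q : τ.pathSpace) : Prop :=
  ∃ k : ℕ, (∀ j < k, (p.1.2 j).IsMaximal) ∧ (p.1.2 k).IsSuccessor (q.1.2 k) ∧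
    (∀ j < k, (q.1.2 j).IsMinimal) ∧ ∀ j > k, q.1.2 j = p.1.2 j

/-- `V` is an adic (Bratteli–Vershik) map of the ordered diagram of `τ`: a continuous extension to
the whole path space of the successor map on the paths that are not maximal. -/
def IsAdicMap {A : Type} [TopologicalSpace A] (τ : Substitution A)
    (V : τ.pathSpace → τ.pathSpace) : Prop :=
  Continuous V ∧ ∀ p, ¬ IsMaximalPath p → IsPathSuccessor p (V p)

end Substitution

/-- `y` has exactly `M` preimages under `T`. -/
def HasPreimageCount {Y : Type} (T : Y → Y) (y : Y) (M : ℕ) : Prop :=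
  {z | T z = y}.encard = (M : ℕ∞)

namespace Substitution

open Filter Topology

variable {A : Type}

/-! Some power `θ` of `τ` fixes every first letter, has images of length at least two, and lets
every image contain all two-letter words of the language (`exists_pow_covering`). It has the same
subshift as `τ`. Since `θ` is expanding, a sequence fixed by one of its powers is determined by its
first letter, which gives one such sequence per letter.

Take for `τ'` the substitution sending a block `(a, c)` to the two-letter blocks of `θ(a)c`. As
`θ(c)` begins with `c`, it commutes with the 2-block recoding (`onSeq_recode`), which is therefore a
conjugacy of subshifts matching fixed points and preserving preimage counts. The last block of the
image is `(last letter of θ(a), c)`, so `τ'` is suffix-permutative; every image contains every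
block, so it is primitive.

For the adic model, a point is sent to the path of its iterated desubstitutions. This requires
one-sided recognizability (`parsing_unique`): by pigeonhole, two parsings either force periodicity
or share a cut, where prefix-permutativity locates the cut and suffix-permutativity determines
everything to its left. The path determines the point because the first block of the image of `(a,
c)` depends on `a` only, and `a` is already visible in the preceding block (`toPath_injective`).
Transporting the shift along this homeomorphism yields a continuous map, defined at maximal paths
too. -/

theorem seqShift_iterate_apply (k : ℕ) (x : ℕ → A) (m : ℕ) : seqShift^[k] x m = x (m + k) := by
  induction k generalizing m with
  | zero => rfl
  | succ k ih =>
    rw [Function.iterate_succ_apply', seqShift, ih]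
    congr 1
    omega

/-- The position in `τ(x)` at which the image of the letter `x i` begins. -/
def cut (τ : Substitution A) (x : ℕ → A) (i : ℕ) : ℕ :=
  ∑ t ∈ Finset.range i, (τ.word (x t)).length

/-! ### Cuts and the action on one-sided sequences -/

section Cut

variable (τ : Substitution A) (x y : ℕ → A)

theorem length_word_pos (a : A) : 0 < (τ.word a).length :=
  List.length_pos_of_ne_nil (τ.word_ne_nil a)

@[simp] theorem cut_zero : τ.cut x 0 = 0 := rfl

theorem cut_succ (i : ℕ) : τ.cut x (i + 1) = τ.cut x i + (τ.word (x i)).length :=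
  Finset.sum_range_succ _ _

theorem cut_add (i j : ℕ) : τ.cut x (i + j) = τ.cut x i + τ.cut (seqShift^[i] x) j := by
  simp only [cut, Finset.sum_range_add, seqShift_iterate_apply, add_comm _ i]

theorem cut_strictMono : StrictMono (τ.cut x) :=
  strictMono_nat_of_lt_succ fun i => by
    have := τ.length_word_pos (x i)
    rw [cut_succ]
    omega

variable {x y} in
theorem cut_congr {i : ℕ} (h : ∀ t < i, x t = y t) : τ.cut x i = τ.cut y i :=
  Finset.sum_congr rfl fun t ht => by rw [h t (Finset.mem_range.1 ht)]

theorem exists_eq_cut_add (m : ℕ) :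
    ∃ i d, d < (τ.word (x i)).length ∧ m = τ.cut x i + d := by
  induction m with
  | zero => exact ⟨0, 0, τ.length_word_pos _, rfl⟩
  | succ m ih =>
    obtain ⟨i, d, hd, rfl⟩ := ih
    by_cases h : d + 1 < (τ.word (x i)).length
    · exact ⟨i, d + 1, h, rfl⟩
    · refine ⟨i + 1, 0, τ.length_word_pos _, ?_⟩
      rw [cut_succ]
      omega

theorem onWord_append (u v : List A) : τ.onWord (u ++ v) = τ.onWord u ++ τ.onWord v := by
  simp [onWord]

theorem onWord_singleton (a : A) : τ.onWord [a] = τ.word a := by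
  simp [onWord]

theorem length_onWord_map_range (m : ℕ) :
    (τ.onWord ((List.range m).map x)).length = τ.cut x m := by
  induction m with
  | zero => simp [onWord]
  | succ m ih =>
    rw [List.range_succ, List.map_append, onWord_append, List.length_append, ih, cut_succ]
    simp [onWord]

theorem onWord_map_range_prefix {m k : ℕ} (h : m ≤ k) :
    τ.onWord ((List.range m).map x) <+: τ.onWord ((List.range k).map x) := by
  induction k, h using Nat.le_induction with
  | base => exact List.prefix_rfl
  | succ k _ ih =>
    refine ih.trans ?_
    rw [List.range_succ, List.map_append, onWord_append]
    exact List.prefix_append _ _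

theorem getElem?_onWord_map_range {m k : ℕ} (h : m < τ.cut x k) :
    (τ.onWord ((List.range k).map x))[m]? = some (τ.onSeq x m) := by
  have h1 : (τ.onWord ((List.range (m + 1)).map x))[m]? = some (τ.onSeq x m) :=
    List.getElem?_eq_getElem _
  have hm : m < (τ.onWord ((List.range (m + 1)).map x)).length :=
    (List.getElem?_eq_some_iff.1 h1).1
  rw [← length_onWord_map_range] at h
  rcases le_total (m + 1) k with hk | hk
  · obtain ⟨t, ht⟩ := τ.onWord_map_range_prefix x hk
    rw [← h1, ← ht, List.getElem?_append_left hm]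
  · obtain ⟨t, ht⟩ := τ.onWord_map_range_prefix x hk
    rw [← h1, ← ht, List.getElem?_append_left h]

theorem getElem?_word (i d : ℕ) (hd : d < (τ.word (x i)).length) :
    (τ.word (x i))[d]? = some (τ.onSeq x (τ.cut x i + d)) := by
  rw [← τ.getElem?_onWord_map_range x (k := i + 1) (by rw [cut_succ]; omega),
    List.range_succ, List.map_append, onWord_append, List.getElem?_append_right
      (by rw [length_onWord_map_range]; omega), length_onWord_map_range]
  simp [onWord]

theorem onSeq_cut_add (i d : ℕ) (hd : d < (τ.word (x i)).length) :
    τ.onSeq x (τ.cut x i + d) = (τ.word (x i))[d] := by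
  have := τ.getElem?_word x i d hd
  rw [List.getElem?_eq_getElem hd] at this
  exact (Option.some.inj this).symm

theorem onSeq_cut (i : ℕ) : τ.onSeq x (τ.cut x i) = τ.firstLetter (x i) := by
  have := τ.onSeq_cut_add x i 0 (τ.length_word_pos _)
  rw [add_zero] at this
  rw [this, firstLetter, List.head_eq_getElem]

theorem onSeq_zero : τ.onSeq x 0 = τ.firstLetter (x 0) := τ.onSeq_cut x 0

theorem onSeq_lt (d : ℕ) (hd : d < (τ.word (x 0)).length) :
    τ.onSeq x d = (τ.word (x 0))[d] := by
  simpa using τ.onSeq_cut_add x 0 d hd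

theorem onSeq_cut_succ_sub_one (i : ℕ) :
    τ.onSeq x (τ.cut x (i + 1) - 1) = τ.lastLetter (x i) := by
  have h := τ.length_word_pos (x i)
  have := τ.onSeq_cut_add x i ((τ.word (x i)).length - 1) (by omega)
  rw [cut_succ, Nat.add_sub_assoc (by omega), this, lastLetter, List.getLast_eq_getElem]

theorem seqShift_cut_onSeq (i : ℕ) :
    seqShift^[τ.cut x i] (τ.onSeq x) = τ.onSeq (seqShift^[i] x) := by
  funext m
  obtain ⟨j, d, hd, rfl⟩ := τ.exists_eq_cut_add (seqShift^[i] x) m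
  have key := τ.onSeq_cut_add x (j + i) d (by rwa [seqShift_iterate_apply] at hd)
  rw [onSeq_cut_add _ _ _ _ hd, seqShift_iterate_apply]
  simp only [seqShift_iterate_apply]
  rw [← key, add_comm j i, cut_add]
  congr 1
  omega

variable {x y} in
theorem onSeq_congr {r : ℕ} (h : ∀ i < r, x i = y i) {m : ℕ} (hm : m < τ.cut x r) :
    τ.onSeq x m = τ.onSeq y m := by
  have h1 := τ.getElem?_onWord_map_range x hm
  have h2 := τ.getElem?_onWord_map_range y (τ.cut_congr h ▸ hm)
  have h3 : (List.range r).map x = (List.range r).map y :=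
    List.map_congr_left fun i hi => h i (List.mem_range.1 hi)
  rw [h3, h2] at h1
  exact (Option.some.inj h1).symm

theorem le_cut (r : ℕ) : r ≤ τ.cut x r := (τ.cut_strictMono x).le_apply

theorem two_mul_le_cut (hτ : ∀ a, 2 ≤ (τ.word a).length) (r : ℕ) : 2 * r ≤ τ.cut x r := by
  induction r with
  | zero => simp
  | succ r ih =>
    have := hτ (x r)
    rw [cut_succ]
    omega

end Cut

theorem continuous_of_finitely_determined [TopologicalSpace A] [DiscreteTopology A]
    {B : Type*} [TopologicalSpace B] (f : (ℕ → A) → B) (m : ℕ)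
    (h : ∀ x y : ℕ → A, (∀ i < m, x i = y i) → f x = f y) : Continuous f := by
  refine IsLocallyConstant.continuous ((IsLocallyConstant.iff_exists_open f).2 fun x => ?_)
  refine ⟨(Set.Iio m).pi fun i => {x i}, isOpen_set_pi (Set.finite_Iio m) fun i _ =>
    isOpen_discrete _, fun i _ => rfl, fun y hy => h _ _ fun i hi => hy i hi⟩

theorem continuous_onSeq [TopologicalSpace A] [DiscreteTopology A] (τ : Substitution A) :
    Continuous τ.onSeq :=
  continuous_pi fun m => continuous_of_finitely_determined _ (m + 1) fun x _ h =>
    τ.onSeq_congr h (τ.le_cut x (m + 1))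

theorem continuous_seqShift [TopologicalSpace A] : Continuous (seqShift : (ℕ → A) → ℕ → A) :=
  continuous_pi fun m => continuous_apply (m + 1)

/-! ### Composition and powers -/

/-- Composition of substitutions. -/
def comp (σ τ : Substitution A) : Substitution A where
  word a := σ.onWord (τ.word a)
  word_ne_nil a h := by
    have h1 := σ.length_le_onWord (τ.word a)
    have h2 := τ.length_word_pos a
    rw [h, List.length_nil] at h1
    omega

theorem onWord_comp (σ τ : Substitution A) (w : List A) :
    (σ.comp τ).onWord w = σ.onWord (τ.onWord w) := by
  simp [onWord, comp, List.flatMap_assoc]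

theorem map_range_onSeq (τ : Substitution A) (x : ℕ → A) (k : ℕ) :
    (List.range (τ.cut x k)).map (τ.onSeq x) = τ.onWord ((List.range k).map x) := by
  refine List.ext_getElem? fun m => ?_
  rcases lt_or_ge m (τ.cut x k) with h | h
  · rw [τ.getElem?_onWord_map_range x h]
    simp [h]
  · rw [List.getElem?_eq_none, List.getElem?_eq_none]
    · rwa [length_onWord_map_range]
    · simpa using h

theorem onSeq_comp (σ τ : Substitution A) (x : ℕ → A) :
    (σ.comp τ).onSeq x = σ.onSeq (τ.onSeq x) := by
  funext m
  have h1 := (σ.comp τ).getElem?_onWord_map_range x ((σ.comp τ).le_cut x (m + 1))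
  have h2 := σ.getElem?_onWord_map_range (τ.onSeq x) (m := m) (k := τ.cut x (m + 1))
    ((τ.le_cut x (m + 1)).trans (σ.le_cut _ _))
  rw [map_range_onSeq] at h2
  rw [onWord_comp, h2] at h1
  exact (Option.some.inj h1).symm

theorem firstLetter_comp (σ τ : Substitution A) (a : A) :
    (σ.comp τ).firstLetter a = σ.firstLetter (τ.firstLetter a) := by
  have := (σ.comp τ).onSeq_zero fun _ => a
  rw [onSeq_comp, onSeq_zero, onSeq_zero] at this
  exact this.symm

theorem lastLetter_comp (σ τ : Substitution A) (a : A) :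
    (σ.comp τ).lastLetter a = σ.lastLetter (τ.lastLetter a) := by
  have h : (σ.comp τ).word a =
      σ.onWord (τ.word a).dropLast ++ σ.word (τ.lastLetter a) := by
    rw [← σ.onWord_singleton, ← onWord_append, lastLetter, List.dropLast_append_getLast]
    rfl
  simp only [lastLetter, h]
  exact List.getLast_append_of_ne_nil _ (σ.word_ne_nil _)

/-- The powers of a substitution. -/
def pow (τ : Substitution A) : ℕ → Substitution A
  | 0 => ⟨fun a => [a], fun _ => List.cons_ne_nil _ _⟩
  | p + 1 => τ.comp (τ.pow p)

section Pow

variable (τ : Substitution A) (p : ℕ)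

theorem word_pow (a : A) : (τ.pow p).word a = τ.onWord^[p] [a] := by
  induction p with
  | zero => rfl
  | succ p ih => rw [Function.iterate_succ_apply', ← ih]; rfl

theorem onSeq_pow : (τ.pow p).onSeq = τ.onSeq^[p] := by
  induction p with
  | zero =>
    funext x m
    have := (τ.pow 0).onSeq_cut_add x m 0 Nat.one_pos
    simpa [pow, cut] using this
  | succ p ih =>
    funext x
    rw [Function.iterate_succ_apply', ← ih]
    exact onSeq_comp _ _ _

theorem onWord_pow : (τ.pow p).onWord = τ.onWord^[p] := by
  induction p with
  | zero =>
    funext w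
    simp [pow, onWord]
  | succ p ih =>
    funext w
    rw [Function.iterate_succ_apply', ← ih]
    exact onWord_comp _ _ _

theorem firstLetter_pow : (τ.pow p).firstLetter = τ.firstLetter^[p] := by
  induction p with
  | zero => rfl
  | succ p ih =>
    funext a
    rw [Function.iterate_succ_apply', ← ih]
    exact firstLetter_comp _ _ _

theorem lastLetter_pow : (τ.pow p).lastLetter = τ.lastLetter^[p] := by
  induction p with
  | zero => rfl
  | succ p ih =>
    funext a
    rw [Function.iterate_succ_apply', ← ih]
    exact lastLetter_comp _ _ _

-- The subshift depends only on `powerFixed`, so this is what makes replacing `τ` by a power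
-- harmless.
variable {p} in
theorem powerFixed_pow (hp : 0 < p) : (τ.pow p).powerFixed = τ.powerFixed := by
  ext u
  constructor
  · rintro ⟨q, hq, h⟩
    rw [onSeq_pow, ← Function.iterate_mul] at h
    exact ⟨p * q, Nat.mul_pos hp hq, h⟩
  · rintro ⟨q, hq, h⟩
    refine ⟨q, hq, ?_⟩
    rw [onSeq_pow, ← Function.iterate_mul, mul_comm, Function.iterate_mul]
    exact Function.iterate_fixed h p

end Pow

/-! ### Fixed points of expanding substitutions -/

section Fixed

variable {τ : Substitution A}

theorem onSeq_agree (hτ : ∀ a, 2 ≤ (τ.word a).length) {x y : ℕ → A} {r : ℕ}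
    (h : ∀ i < r, x i = y i) : ∀ i < 2 * r, τ.onSeq x i = τ.onSeq y i := fun _ hi =>
  τ.onSeq_congr h (hi.trans_le (τ.two_mul_le_cut x hτ r))

theorem onSeq_iterate_agree (hτ : ∀ a, 2 ≤ (τ.word a).length) {x y : ℕ → A} {r p : ℕ}
    (h : ∀ i < r, x i = y i) :
    ∀ i < 2 ^ p * r, τ.onSeq^[p] x i = τ.onSeq^[p] y i := by
  induction p with
  | zero => simpa using h
  | succ p ih =>
    intro i hi
    simp only [Function.iterate_succ_apply']
    exact onSeq_agree hτ ih i (by rw [pow_succ] at hi; linarith)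

/-- A sequence fixed by a power of an expanding substitution is determined by its first letter. -/
theorem eq_of_onSeq_iterate_eq (hτ : ∀ a, 2 ≤ (τ.word a).length) {u v : ℕ → A} {p : ℕ}
    (hp : 0 < p) (hu : τ.onSeq^[p] u = u) (hv : τ.onSeq^[p] v = v) (h : u 0 = v 0) : u = v := by
  have key : ∀ r, ∀ i < r + 1, u i = v i := by
    intro r
    induction r with
    | zero =>
      intro i hi
      rwa [Nat.lt_one_iff.1 hi]
    | succ r ih =>
      intro i hi
      have h2 := onSeq_iterate_agree hτ (p := p) ih i (by
        have : 2 ^ 1 ≤ 2 ^ p := Nat.pow_le_pow_right (by norm_num) hp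
        nlinarith)
      rwa [hu, hv] at h2
  exact funext fun i => key i i (Nat.lt_succ_self i)

theorem eq_of_onSeq_eq (hτ : ∀ a, 2 ≤ (τ.word a).length) {u v : ℕ → A}
    (hu : τ.onSeq u = u) (hv : τ.onSeq v = v) (h : u 0 = v 0) : u = v :=
  eq_of_onSeq_iterate_eq hτ one_pos hu hv h

/-- The iterates on the constant sequence `a` stabilize: the `m`-th agrees with all later ones on
its first `m + 1` letters, because each application doubles the agreement. The fixed point is their
diagonal. -/
theorem exists_onSeq_eq (hτ : ∀ a, 2 ≤ (τ.word a).length) {a : A} (ha : τ.firstLetter a = a) :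
    ∃ u, τ.onSeq u = u ∧ u 0 = a := by
  let s : ℕ → ℕ → A := fun m => τ.onSeq^[m] fun _ => a
  have hs : ∀ m, s (m + 1) = τ.onSeq (s m) := fun m => Function.iterate_succ_apply' _ _ _
  have h1 : ∀ m, ∀ i < m + 1, s m i = s (m + 1) i := by
    intro m
    induction m with
    | zero =>
      intro i hi
      rw [Nat.lt_one_iff.1 hi, hs, onSeq_zero]
      exact ha.symm
    | succ m ih =>
      intro i hi
      rw [hs (m + 1), hs m]
      exact onSeq_agree hτ (hs m ▸ ih) i (by omega)
  have h2 : ∀ m, ∀ i < m + 1, s m i = s i i := by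
    intro m
    induction m with
    | zero =>
      intro i hi
      rw [Nat.lt_one_iff.1 hi]
    | succ m ih =>
      intro i hi
      rcases Nat.lt_succ_iff_lt_or_eq.1 hi with h | h
      · rw [← h1 m i h, ih i h]
      · rw [h]
  refine ⟨fun i => s i i, funext fun m => ?_, rfl⟩
  have h3 : τ.onSeq (fun i => s i i) m = τ.onSeq (s m) m :=
    onSeq_agree hτ (r := m + 1) (fun i hi => (h2 m i hi).symm) m (by omega)
  rw [h3, ← hs, ← h1 m m (Nat.lt_succ_self m)]

theorem onSeq_iterate_zero (p : ℕ) (x : ℕ → A) :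
    τ.onSeq^[p] x 0 = τ.firstLetter^[p] (x 0) := by
  rw [← onSeq_pow, onSeq_zero, firstLetter_pow]

/-- The first letter of a sequence fixed by a power lies in the range of `firstLetter`, hence is
itself fixed, and the fixed point of `τ` starting there is the only candidate. Idempotence is the
right generality because the first-letter map of the block substitution need not be a permutation.
-/
theorem powerFixed_eq_of_idempotent (hτ : ∀ a, 2 ≤ (τ.word a).length)
    (hF : ∀ a, τ.firstLetter (τ.firstLetter a) = τ.firstLetter a) :
    τ.powerFixed = {u | τ.onSeq u = u} := by
  ext u
  refine ⟨?_, fun h => ⟨1, one_pos, h⟩⟩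
  rintro ⟨p, hp, hu⟩
  have h0 : τ.firstLetter (u 0) = u 0 := by
    obtain ⟨q, rfl⟩ := Nat.exists_eq_succ_of_ne_zero hp.ne'
    rw [← hu, onSeq_iterate_zero, Function.iterate_succ_apply', hF]
  obtain ⟨v, hv, hv0⟩ := exists_onSeq_eq hτ h0
  rwa [eq_of_onSeq_iterate_eq hτ hp hu (Function.iterate_fixed hv p) hv0.symm]

end Fixed

/-! ### One-sided recognizability -/

section Recognizable

variable {τ : Substitution A}

/-- For a prefix-permutative substitution, the images of two distinct sequences agree up to a
common cut, at which they differ. -/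
theorem exists_first_difference (hF : Function.Injective τ.firstLetter) {x y : ℕ → A}
    (h : x ≠ y) : ∃ i, (∀ t < i, x t = y t) ∧
      τ.onSeq x (τ.cut x i) ≠ τ.onSeq y (τ.cut x i) ∧
      ∀ m < τ.cut x i, τ.onSeq x m = τ.onSeq y m := by
  classical
  have hex : ∃ i, x i ≠ y i := Function.ne_iff.1 h
  have hmin : ∀ t < Nat.find hex, x t = y t := fun t ht => not_not.1 (Nat.find_min hex ht)
  refine ⟨Nat.find hex, hmin, ?_, fun m hm => τ.onSeq_congr hmin hm⟩
  rw [onSeq_cut, τ.cut_congr hmin, onSeq_cut]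
  exact fun h => Nat.find_spec hex (hF h)

theorem onSeq_injective (hF : Function.Injective τ.firstLetter) :
    Function.Injective τ.onSeq := by
  intro x y h
  by_contra hne
  obtain ⟨i, -, h2, -⟩ := exists_first_difference hF hne
  exact h2 (congrFun h _)

/-- Two overlapping parsings in the same state have equal futures or reach a common cut. -/
theorem exists_common_cut_of_ne (hF : Function.Injective τ.firstLetter) {y y' z z' : ℕ → A}
    {d : ℕ} (hd : d < (τ.word (z 0)).length) (hz : z 0 = z' 0)
    (h : seqShift^[d] (τ.onSeq z) = τ.onSeq y) (h' : seqShift^[d] (τ.onSeq z') = τ.onSeq y')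
    (hne : y ≠ y') : ∃ i j, 0 < j ∧ τ.cut z j = d + τ.cut y i := by
  have hy : ∀ m, τ.onSeq z (m + d) = τ.onSeq y m := fun m => by
    rw [← h, seqShift_iterate_apply]
  have hy' : ∀ m, τ.onSeq z' (m + d) = τ.onSeq y' m := fun m => by
    rw [← h', seqShift_iterate_apply]
  obtain ⟨i, -, hi1, hi2⟩ := exists_first_difference hF hne
  have hzne : z ≠ z' := by
    rintro rfl
    exact hi1 (by rw [← hy, ← hy'])
  obtain ⟨j, hj0, hj1, hj2⟩ := exists_first_difference hF hzne
  have hj : 0 < j := by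
    rcases Nat.eq_zero_or_pos j with rfl | hj
    · rw [cut_zero, onSeq_zero, onSeq_zero, hz] at hj1
      exact absurd rfl hj1
    · exact hj
  refine ⟨i, j, hj, ?_⟩
  have hdj : (τ.word (z 0)).length ≤ τ.cut z j := by
    have h1 : τ.cut z 1 ≤ τ.cut z j := (τ.cut_strictMono z).monotone hj
    rwa [cut_succ, cut_zero, zero_add] at h1
  -- Both positions mark the first disagreement of the same pair of sequences, seen through the two
  -- parsings; if one came first, the other parsing would force agreement there.
  rcases lt_trichotomy (τ.cut z j) (d + τ.cut y i) with hlt | heq | hgt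
  · refine absurd ?_ hj1
    have h3 := hi2 (τ.cut z j - d) (by omega)
    rwa [← hy, ← hy', Nat.sub_add_cancel (by omega)] at h3
  · exact heq
  · refine absurd ?_ hi1
    have h3 := hj2 (τ.cut y i + d) (by omega)
    rwa [hy, hy'] at h3

/-- Going left from a common cut, the parsings with respect to a suffix-permutative substitution
are determined. -/
theorem eq_of_common_cut (hL : Function.Injective τ.lastLetter) {y z : ℕ → A} {k l : ℕ}
    (hk : k < (τ.word (y 0)).length) (hl : l < (τ.word (z 0)).length)
    (h : ∀ m, τ.onSeq y (m + k) = τ.onSeq z (m + l)) (i j : ℕ)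
    (hij : τ.cut y (i + 1) + l = τ.cut z (j + 1) + k) : k = l ∧ y 0 = z 0 := by
  have hcy : ∀ i, k < τ.cut y (i + 1) := fun i => hk.trans_le <| by
    rw [add_comm, cut_add, cut_succ, cut_zero]
    omega
  have hcz : ∀ j, l < τ.cut z (j + 1) := fun j => hl.trans_le <| by
    rw [add_comm, cut_add, cut_succ, cut_zero]
    omega
  induction i generalizing j with
  | zero =>
    -- The letters just before the common cut are last letters of `τ (y 0)` and `τ (z j)`.
    have e : y 0 = z j := hL <| by
      rw [← onSeq_cut_succ_sub_one, ← onSeq_cut_succ_sub_one]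
      have h1 := hcy 0
      have h2 := hcz j
      have h3 := h (τ.cut y (0 + 1) - 1 - k)
      rw [Nat.sub_add_cancel (by omega)] at h3
      rw [h3]
      congr 1
      omega
    rw [cut_succ, cut_succ, e, cut_zero] at hij
    cases j with
    | zero =>
      rw [cut_zero] at hij
      exact ⟨by omega, e⟩
    | succ j =>
      have := hcz j
      omega
  | succ i ih =>
    have e : y (i + 1) = z j := hL <| by
      rw [← onSeq_cut_succ_sub_one, ← onSeq_cut_succ_sub_one]
      have h1 := hcy (i + 1)
      have h2 := hcz j
      have h3 := h (τ.cut y (i + 1 + 1) - 1 - k)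
      rw [Nat.sub_add_cancel (by omega)] at h3
      rw [h3]
      congr 1
      omega
    rw [cut_succ, cut_succ _ _ j, e] at hij
    cases j with
    | zero =>
      have := hcy i
      rw [cut_zero] at hij
      omega
    | succ j => exact ih j (by omega)

/-- One-sided recognizability of prefix- and suffix-permutative substitutions at sequences that
are not eventually periodic. -/
theorem parsing_unique [Finite A] (hF : Function.Injective τ.firstLetter)
    (hL : Function.Injective τ.lastLetter) {y z : ℕ → A} {k l : ℕ}
    (hk : k < (τ.word (y 0)).length) (hl : l < (τ.word (z 0)).length)
    (h : seqShift^[k] (τ.onSeq y) = seqShift^[l] (τ.onSeq z))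
    (hap : ∀ q r : ℕ, 0 < r →
      seqShift^[r] (seqShift^[q] (τ.onSeq y)) ≠ seqShift^[q] (τ.onSeq y)) :
    k = l ∧ y = z := by
  have hm : ∀ m, τ.onSeq y (m + k) = τ.onSeq z (m + l) := fun m => by
    simpa only [seqShift_iterate_apply] using congrFun h m
  -- A common cut fixes `k = l` and the first letters; then the deleted prefixes agree as well, and
  -- injectivity of `onSeq` gives `y = z`.
  suffices hc : ∃ i j, τ.cut y (i + 1) + l = τ.cut z (j + 1) + k by
    obtain ⟨i, j, hij⟩ := hc
    obtain ⟨rfl, h0⟩ := eq_of_common_cut hL hk hl hm i j hij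
    refine ⟨rfl, onSeq_injective hF (funext fun m => ?_)⟩
    rcases lt_or_ge m k with hmk | hmk
    · rw [onSeq_lt _ _ _ (hmk.trans hk), onSeq_lt _ _ _ (hmk.trans hl)]
      simp only [h0]
    · have := hm (m - k)
      rwa [Nat.sub_add_cancel hmk] at this
  have hcy : ∀ i, k < τ.cut y (i + 1) := fun i => hk.trans_le <| by
    rw [add_comm, cut_add, cut_succ, cut_zero]
    omega
  -- Each cut of `y` falls at offset `D i` inside the image of the letter `z (J i)`. There are
  -- finitely many such states, so two cuts share one.
  choose J D hD hJ using fun i => τ.exists_eq_cut_add z (τ.cut y (i + 1) - k + l)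
  have hy : ∀ i, seqShift^[D i] (τ.onSeq (seqShift^[J i] z)) =
      τ.onSeq (seqShift^[i + 1] y) := fun i => by
    rw [← seqShift_cut_onSeq, ← seqShift_cut_onSeq]
    funext m
    simp only [seqShift_iterate_apply]
    have h1 := hJ i
    have h2 := hcy i
    have h3 := hm (m + τ.cut y (i + 1) - k)
    rw [Nat.sub_add_cancel (by omega)] at h3
    rw [h3]
    congr 1
    omega
  obtain ⟨i, i', hii, he⟩ := Finite.exists_ne_map_eq_of_infinite
    fun i => (⟨z (J i), D i, hD i⟩ : τ.Edge)
  wlog hlt : i < i' generalizing i i'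
  · exact this i' i hii.symm he.symm (by omega)
  have hz : z (J i) = z (J i') := congrArg Sigma.fst he
  have hd : D i = D i' := by
    have := congrArg (fun e : τ.Edge => (e.2 : ℕ)) he
    exact this
  -- Equal futures would make a tail of `τ(y)` periodic; distinct futures from one state produce a
  -- common cut.
  by_cases hne : seqShift^[i + 1] y = seqShift^[i' + 1] y
  · refine absurd ?_ (hap (τ.cut y (i + 1)) (τ.cut y (i' + 1) - τ.cut y (i + 1)) ?_)
    · have hle : τ.cut y (i + 1) < τ.cut y (i' + 1) := τ.cut_strictMono y (by omega)
      rw [← Function.iterate_add_apply, Nat.sub_add_cancel hle.le, seqShift_cut_onSeq,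
        seqShift_cut_onSeq, hne]
    · exact Nat.sub_pos_of_lt (τ.cut_strictMono y (by omega))
  · obtain ⟨s, t, ht, hst⟩ := exists_common_cut_of_ne (z := seqShift^[J i] z)
      (z' := seqShift^[J i'] z) (d := D i) hF
      (by rw [seqShift_iterate_apply, zero_add]; exact hD i)
      (by simpa only [seqShift_iterate_apply, zero_add] using hz) (hy i) (hd ▸ hy i') hne
    obtain ⟨t, rfl⟩ := Nat.exists_eq_succ_of_ne_zero ht.ne'
    refine ⟨i + s, J i + t, ?_⟩
    have h1 := τ.cut_add z (J i) (t + 1)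
    have h2 := τ.cut_add y (i + 1) s
    have h3 := hJ i
    have h4 := hcy i
    rw [show i + s + 1 = i + 1 + s by omega, add_assoc (J i)]
    rw [Nat.succ_eq_add_one] at hst
    omega

end Recognizable

section Edge

variable {ρ : Substitution A}

theorem Edge.ext_val {e f : ρ.Edge} (h1 : e.1 = f.1) (h2 : (e.2 : ℕ) = f.2) : e = f := by
  obtain ⟨a, i⟩ := e
  obtain ⟨b, j⟩ := f
  obtain rfl : a = b := h1
  obtain rfl : i = j := Fin.ext h2
  rfl

theorem seqShift_onSeq_zero {y : ℕ → A} {e : ρ.Edge} (he : e.range = y 0) :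
    seqShift^[(e.2 : ℕ)] (ρ.onSeq y) 0 = e.source := by
  obtain ⟨a, d⟩ := e
  obtain rfl : a = y 0 := he
  rw [seqShift_iterate_apply, zero_add, onSeq_lt _ _ _ d.2]
  rfl

end Edge

/-! ### Invariance of the subshift -/

section Subshift

variable [TopologicalSpace A] {τ : Substitution A}

theorem seqShift_mem_subshift {x : ℕ → A} (hx : x ∈ τ.subshift) (m : ℕ) :
    seqShift^[m] x ∈ τ.subshift :=
  τ.mapsTo_seqShift_subshift.iterate m hx

theorem mem_subshift_of_powerFixed {u : ℕ → A} (hu : u ∈ τ.powerFixed) : u ∈ τ.subshift :=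
  subset_closure ⟨u, hu, 0, rfl⟩

theorem isClosed_subshift : IsClosed τ.subshift := isClosed_closure

theorem onSeq_mem_subshift [DiscreteTopology A] (hfix : τ.powerFixed ⊆ {u | τ.onSeq u = u})
    {x : ℕ → A} (hx : x ∈ τ.subshift) : τ.onSeq x ∈ τ.subshift := by
  refine Set.MapsTo.closure ?_ τ.continuous_onSeq hx
  rintro _ ⟨u, hu, m, rfl⟩
  refine ⟨u, hu, τ.cut u m, ?_⟩
  rw [← seqShift_cut_onSeq, hfix hu]

end Subshift

/-! ### Desubstitution as a homeomorphism -/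

section Adic

variable [TopologicalSpace A] [DiscreteTopology A] {ρ : Substitution A}

/-- Pairs of a sequence `y` of the subshift and an edge whose range is the first letter of `y`. -/
def markedSequences (ρ : Substitution A) : Set (ρ.subshift × ρ.Edge) :=
  {q | q.2.range = q.1.1 0}

/-- The sequence that is obtained from `ρ(y)` by deleting the letters before the marked edge. -/
def unmark (hfix : ρ.powerFixed ⊆ {u | ρ.onSeq u = u}) (q : ρ.markedSequences) : ρ.subshift :=
  ⟨seqShift^[(q.1.2.2 : ℕ)] (ρ.onSeq q.1.1.1),
    seqShift_mem_subshift (onSeq_mem_subshift hfix q.1.1.2) _⟩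

theorem continuous_unmark (hfix : ρ.powerFixed ⊆ {u | ρ.onSeq u = u}) :
    Continuous (unmark hfix) := by
  refine Continuous.subtype_mk ?_ _
  have h : Continuous fun p : ρ.Edge × (ℕ → A) => seqShift^[(p.1.2 : ℕ)] (ρ.onSeq p.2) :=
    continuous_prod_of_discrete_left.2 fun e =>
      (continuous_seqShift.iterate (e.2 : ℕ)).comp ρ.continuous_onSeq
  exact h.comp ((continuous_snd.comp continuous_subtype_val).prodMk
    (continuous_subtype_val.comp (continuous_fst.comp continuous_subtype_val)))

/-- A recognizable substitution: a sequence of the subshift is in at most one way a tail of the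
image of a sequence of the subshift, cut inside the image of the first letter. -/
def Recognizable (ρ : Substitution A) : Prop :=
  ∀ y ∈ ρ.subshift, ∀ z ∈ ρ.subshift, ∀ k l : ℕ, k < (ρ.word (y 0)).length →
    l < (ρ.word (z 0)).length → seqShift^[k] (ρ.onSeq y) = seqShift^[l] (ρ.onSeq z) →
    k = l ∧ y = z

theorem unmark_injective (hfix : ρ.powerFixed ⊆ {u | ρ.onSeq u = u}) (hrec : ρ.Recognizable) :
    Function.Injective (unmark hfix) := by
  rintro ⟨⟨y, e⟩, he⟩ ⟨⟨z, f⟩, hf⟩ h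
  change e.1 = y.1 0 at he
  change f.1 = z.1 0 at hf
  obtain ⟨h1, h2⟩ := hrec y.1 y.2 z.1 z.2 e.2 f.2 (he ▸ e.2.2) (hf ▸ f.2.2)
    (congrArg Subtype.val h)
  obtain rfl : y = z := Subtype.ext h2
  obtain rfl : e = f := Edge.ext_val (he.trans hf.symm) h1
  rfl

variable [Finite A]

instance : CompactSpace ρ.subshift := isCompact_iff_compactSpace.1 isClosed_subshift.isCompact

instance : CompactSpace ρ.markedSequences := by
  refine isCompact_iff_compactSpace.1 (IsClosed.isCompact ?_)
  exact isClosed_eq (continuous_of_discreteTopology.comp continuous_snd)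
    ((continuous_apply 0).comp (continuous_subtype_val.comp continuous_fst))

/-- The range is compact, hence closed, so it suffices to reach the shifts of a fixed point `u`.
Those are reached by parsing `u = ρ(u)`. -/
theorem unmark_surjective (hfix : ρ.powerFixed ⊆ {u | ρ.onSeq u = u}) :
    Function.Surjective (unmark hfix) := by
  have hcl : IsClosed (Set.range fun q => (unmark hfix q).1) :=
    (isCompact_range (continuous_subtype_val.comp (continuous_unmark hfix))).isClosed
  have hsub : ρ.subshift ⊆ Set.range fun q => (unmark hfix q).1 := by
    refine closure_minimal ?_ hcl
    rintro _ ⟨u, hu, m, rfl⟩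
    obtain ⟨i, d, hd, rfl⟩ := ρ.exists_eq_cut_add u m
    refine ⟨⟨(⟨seqShift^[i] u, seqShift_mem_subshift (mem_subshift_of_powerFixed hu) i⟩,
      ⟨u i, d, hd⟩), ?_⟩, ?_⟩
    · change u i = seqShift^[i] u 0
      rw [seqShift_iterate_apply, zero_add]
    · change seqShift^[d] (ρ.onSeq (seqShift^[i] u)) = _
      rw [← seqShift_cut_onSeq, hfix hu, ← Function.iterate_add_apply, add_comm]
  intro x
  obtain ⟨q, hq⟩ := hsub x.2
  exact ⟨q, Subtype.ext hq⟩

/-- Recognizability as a homeomorphism. -/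
noncomputable def mark (hfix : ρ.powerFixed ⊆ {u | ρ.onSeq u = u}) (hrec : ρ.Recognizable) :
    ρ.markedSequences ≃ₜ ρ.subshift :=
  Continuous.homeoOfEquivCompactToT2
    (f := Equiv.ofBijective (unmark hfix) ⟨unmark_injective hfix hrec, unmark_surjective hfix⟩)
    (continuous_unmark hfix)

/-! ### The path of iterated desubstitutions -/

section Path

variable (hfix : ρ.powerFixed ⊆ {u | ρ.onSeq u = u}) (hrec : ρ.Recognizable)

/-- The desubstituted sequence. -/
noncomputable def desub (x : ρ.subshift) : ρ.subshift := ((mark hfix hrec).symm x).1.1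

/-- The position of a sequence inside its desubstitution, as an edge. -/
noncomputable def firstEdge (x : ρ.subshift) : ρ.Edge := ((mark hfix hrec).symm x).1.2

theorem continuous_desub : Continuous (desub hfix hrec) :=
  continuous_fst.comp (continuous_subtype_val.comp (mark hfix hrec).symm.continuous)

theorem continuous_firstEdge : Continuous (firstEdge hfix hrec) :=
  continuous_snd.comp (continuous_subtype_val.comp (mark hfix hrec).symm.continuous)

theorem firstEdge_range (x : ρ.subshift) :
    (firstEdge hfix hrec x).range = (desub hfix hrec x).1 0 :=
  ((mark hfix hrec).symm x).2

theorem seqShift_onSeq_desub (x : ρ.subshift) :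
    seqShift^[((firstEdge hfix hrec x).2 : ℕ)] (ρ.onSeq (desub hfix hrec x).1) = x.1 :=
  congrArg Subtype.val ((mark hfix hrec).apply_symm_apply x)

theorem desub_eq_of_seqShift_onSeq {x y : ρ.subshift} {e : ρ.Edge} (he : e.range = y.1 0)
    (h : seqShift^[(e.2 : ℕ)] (ρ.onSeq y.1) = x.1) :
    desub hfix hrec x = y ∧ firstEdge hfix hrec x = e := by
  have key : (mark hfix hrec).symm x = ⟨(y, e), he⟩ := by
    rw [Homeomorph.symm_apply_eq]
    exact Subtype.ext h.symm
  rw [desub, firstEdge, key]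
  exact ⟨rfl, rfl⟩

theorem firstEdge_source (x : ρ.subshift) : (firstEdge hfix hrec x).source = x.1 0 := by
  rw [← seqShift_onSeq_zero (firstEdge_range hfix hrec x), seqShift_onSeq_desub]

/-- The path of the iterated desubstitutions of a sequence. -/
noncomputable def toPath (x : ρ.subshift) : ρ.pathSpace :=
  ⟨(x.1 0, fun m => firstEdge hfix hrec ((desub hfix hrec)^[m] x)),
    firstEdge_source hfix hrec x, fun m => by
      dsimp only
      rw [firstEdge_source, Function.iterate_succ_apply', firstEdge_range]⟩

theorem continuous_toPath : Continuous (toPath hfix hrec) :=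
  (((continuous_apply 0).comp continuous_subtype_val).prodMk (continuous_pi fun m =>
    (continuous_firstEdge hfix hrec).comp ((continuous_desub hfix hrec).iterate m))).subtype_mk _

theorem toPath_desub {x x' : ρ.subshift} (h : toPath hfix hrec x = toPath hfix hrec x') :
    firstEdge hfix hrec x = firstEdge hfix hrec x' ∧
      toPath hfix hrec (desub hfix hrec x) = toPath hfix hrec (desub hfix hrec x') := by
  have h1 : ∀ m, firstEdge hfix hrec ((desub hfix hrec)^[m] x) =
      firstEdge hfix hrec ((desub hfix hrec)^[m] x') := fun m =>
    congrFun (congrArg (fun p => p.1.2) h) m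
  refine ⟨h1 0, Subtype.ext (Prod.ext ?_ (funext fun m => h1 (m + 1)))⟩
  change (desub hfix hrec x).1 0 = (desub hfix hrec x').1 0
  rw [← firstEdge_range, ← firstEdge_range]
  exact congrArg _ (h1 0)

/-- Equal paths give desubstitutions with equal paths, so agreement of these on `r + 1` letters is
available by induction. Their images then agree up to a cut, and `hg` supplies one further letter,
the one needed when the marked edge is maximal. -/
theorem toPath_injective {g : A → A} (hg : ∀ x ∈ ρ.subshift, ρ.firstLetter (x 1) = g (x 0)) :
    Function.Injective (toPath hfix hrec) := by
  have key : ∀ r (x x' : ρ.subshift), toPath hfix hrec x = toPath hfix hrec x' →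
      ∀ i < r + 1, x.1 i = x'.1 i := by
    intro r
    induction r with
    | zero =>
      intro x x' h i hi
      rw [Nat.lt_one_iff.1 hi]
      exact congrArg (fun p => p.1.1) h
    | succ r ih =>
      intro x x' h i hi
      obtain ⟨he, h'⟩ := toPath_desub hfix hrec h
      have hy := ih _ _ h'
      rw [← seqShift_onSeq_desub hfix hrec x, ← seqShift_onSeq_desub hfix hrec x', he,
        seqShift_iterate_apply, seqShift_iterate_apply]
      have hlt : ((firstEdge hfix hrec x').2 : ℕ) < (ρ.word ((desub hfix hrec x').1 0)).length :=
        firstEdge_range hfix hrec x' ▸ (firstEdge hfix hrec x').2.2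
      rw [← hy 0 (by omega)] at hlt
      have hcut := ρ.cut_add (desub hfix hrec x).1 1 r
      rw [cut_succ, cut_zero, zero_add] at hcut
      have hr := ρ.le_cut (seqShift^[1] (desub hfix hrec x).1) r
      rw [add_comm 1 r] at hcut
      rcases lt_or_ge (i + ((firstEdge hfix hrec x').2 : ℕ))
        (ρ.cut (desub hfix hrec x).1 (r + 1)) with hi' | hi'
      · exact ρ.onSeq_congr hy hi'
      -- The index can pass the known images by at most one, so it is exactly the first letter of
      -- the next image, which `g` reads off from the preceding letter.
      · have hieq : i + ((firstEdge hfix hrec x').2 : ℕ) =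
            ρ.cut (desub hfix hrec x).1 (r + 1) := by omega
        have hnext : ∀ y : ρ.subshift, ρ.firstLetter (y.1 (r + 1)) = g (y.1 r) := fun y => by
          have := hg _ (seqShift_mem_subshift y.2 r)
          rwa [seqShift_iterate_apply, seqShift_iterate_apply, zero_add, add_comm 1 r] at this
        rw [hieq, onSeq_cut, ρ.cut_congr hy, onSeq_cut, hnext, hnext, hy r (by omega)]
  intro x x' h
  exact Subtype.ext (funext fun i => key i x x' h i (Nat.lt_succ_self i))

/-- A finite initial path is realized from its far end: start with a sequence having the right first
letter, then apply `ρ` and delete letters as each edge prescribes. -/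
theorem exists_toPath_agree (hlet : ∀ a, ∃ y ∈ ρ.subshift, y 0 = a) (M : ℕ) (p : ρ.pathSpace) :
    ∃ x : ρ.subshift, x.1 0 = p.1.1 ∧
      ∀ m < M, firstEdge hfix hrec ((desub hfix hrec)^[m] x) = p.1.2 m := by
  induction M generalizing p with
  | zero =>
    obtain ⟨y, hy, h⟩ := hlet p.1.1
    exact ⟨⟨y, hy⟩, h, by simp⟩
  | succ M ih =>
    obtain ⟨y, hy0, hy⟩ := ih ⟨((p.1.2 0).range, fun m => p.1.2 (m + 1)), p.2.2 0,
      fun m => p.2.2 (m + 1)⟩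
    let x : ρ.subshift := unmark hfix ⟨(y, p.1.2 0), hy0.symm⟩
    obtain ⟨hD, hE⟩ := desub_eq_of_seqShift_onSeq hfix hrec (x := x) hy0.symm rfl
    refine ⟨x, ?_, fun m hm => ?_⟩
    · rw [← firstEdge_source hfix hrec, hE]
      exact p.2.1
    · cases m with
      | zero => exact hE
      | succ m =>
        rw [Function.iterate_succ_apply, hD]
        exact hy m (by omega)

/-- The range is dense by `exists_toPath_agree` and closed by compactness. -/
theorem toPath_surjective (hlet : ∀ a, ∃ y ∈ ρ.subshift, y 0 = a) :
    Function.Surjective (toPath hfix hrec) := by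
  intro p
  change p ∈ Set.range (toPath hfix hrec)
  choose x hx0 hx using fun M => exists_toPath_agree hfix hrec hlet M p
  have hcl : IsClosed (Set.range (toPath hfix hrec)) :=
    (isCompact_range (continuous_toPath hfix hrec)).isClosed
  refine hcl.mem_of_tendsto (b := atTop) (f := fun M => toPath hfix hrec (x M)) ?_
    (Eventually.of_forall fun M => ⟨_, rfl⟩)
  rw [tendsto_subtype_rng]
  refine Tendsto.prodMk_nhds (x := p.1.1) (y := p.1.2) ?_ (tendsto_pi_nhds.2 fun m => ?_)
  · exact tendsto_const_nhds.congr fun M => (hx0 M).symm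
  · refine tendsto_const_nhds.congr' ?_
    filter_upwards [eventually_gt_atTop m] with M hM
    exact (hx M m hM).symm

theorem desub_shift_of_not_isMaximal {x : ρ.subshift}
    (h : ¬ (firstEdge hfix hrec x).IsMaximal) :
    desub hfix hrec (ρ.shift x) = desub hfix hrec x ∧
      (firstEdge hfix hrec x).IsSuccessor (firstEdge hfix hrec (ρ.shift x)) := by
  have hlt : ((firstEdge hfix hrec x).2 : ℕ) + 1 <
      (ρ.word (firstEdge hfix hrec x).1).length :=
    lt_of_le_of_ne (firstEdge hfix hrec x).2.2 h
  obtain ⟨h1, h2⟩ := desub_eq_of_seqShift_onSeq hfix hrec (x := ρ.shift x)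
    (y := desub hfix hrec x) (e := ⟨(firstEdge hfix hrec x).1, _, hlt⟩)
    (firstEdge_range hfix hrec x) (by
      rw [Function.iterate_succ_apply', seqShift_onSeq_desub]
      rfl)
  exact ⟨h1, h2 ▸ ⟨rfl, rfl⟩⟩

theorem desub_shift_of_isMaximal {x : ρ.subshift} (h : (firstEdge hfix hrec x).IsMaximal) :
    desub hfix hrec (ρ.shift x) = ρ.shift (desub hfix hrec x) ∧
      (firstEdge hfix hrec (ρ.shift x)).IsMinimal := by
  obtain ⟨h1, h2⟩ := desub_eq_of_seqShift_onSeq hfix hrec (x := ρ.shift x)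
    (y := ρ.shift (desub hfix hrec x))
    (e := ⟨(ρ.shift (desub hfix hrec x)).1 0, 0, ρ.length_word_pos _⟩) rfl (by
      have hr : (firstEdge hfix hrec x).1 = (desub hfix hrec x).1 0 :=
        firstEdge_range hfix hrec x
      have hc : ρ.cut (desub hfix hrec x).1 1 = ((firstEdge hfix hrec x).2 : ℕ) + 1 := by
        rw [cut_succ, cut_zero, zero_add, ← hr]
        exact h.symm
      have := ρ.seqShift_cut_onSeq (desub hfix hrec x).1 1
      rw [hc, Function.iterate_succ_apply', seqShift_onSeq_desub] at this
      exact this.symm)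
  exact ⟨h1, h2 ▸ rfl⟩

/-- As long as the edges are maximal, the shift leaves the current image and acts as the shift one
level up, like a carry in an odometer. The first non-maximal edge absorbs it, and higher levels are
unchanged. -/
theorem isPathSuccessor_toPath_shift {x : ρ.subshift} (h : ¬ IsMaximalPath (toPath hfix hrec x)) :
    IsPathSuccessor (toPath hfix hrec x) (toPath hfix hrec (ρ.shift x)) := by
  classical
  have hex : ∃ K, ¬ (firstEdge hfix hrec ((desub hfix hrec)^[K] x)).IsMaximal :=
    not_forall.1 h
  obtain ⟨K, hK, hmin⟩ : ∃ K, ¬ (firstEdge hfix hrec ((desub hfix hrec)^[K] x)).IsMaximal ∧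
      ∀ j < K, (firstEdge hfix hrec ((desub hfix hrec)^[j] x)).IsMaximal :=
    ⟨Nat.find hex, Nat.find_spec hex, fun j hj => not_not.1 (Nat.find_min hex hj)⟩
  have hD : ∀ j ≤ K, (desub hfix hrec)^[j] (ρ.shift x) = ρ.shift ((desub hfix hrec)^[j] x) := by
    intro j
    induction j with
    | zero => exact fun _ => rfl
    | succ j ih =>
      intro hj
      rw [Function.iterate_succ_apply', ih (by omega),
        (desub_shift_of_isMaximal hfix hrec (hmin j (by omega))).1, Function.iterate_succ_apply']
  obtain ⟨hK1, hK2⟩ := desub_shift_of_not_isMaximal hfix hrec hK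
  refine ⟨K, hmin, ?_, fun j hj => ?_, fun j hj => ?_⟩
  · change Edge.IsSuccessor _ (firstEdge hfix hrec ((desub hfix hrec)^[K] (ρ.shift x)))
    rw [hD K le_rfl]
    exact hK2
  · change (firstEdge hfix hrec ((desub hfix hrec)^[j] (ρ.shift x))).IsMinimal
    rw [hD j hj.le]
    exact (desub_shift_of_isMaximal hfix hrec (hmin j hj)).2
  · obtain ⟨i, rfl⟩ := Nat.exists_eq_add_of_lt hj
    change firstEdge hfix hrec _ = firstEdge hfix hrec _
    rw [add_comm K i, add_assoc, Function.iterate_add_apply, Function.iterate_add_apply _ i,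
      Function.iterate_succ_apply', hD K le_rfl, hK1, Function.iterate_succ_apply']

end Path

/-- The adic representation of a recognizable substitution subshift in which the first letter of
the image of a letter is determined by the preceding letter. -/
theorem exists_adic_representation (hfix : ρ.powerFixed ⊆ {u | ρ.onSeq u = u})
    (hrec : ρ.Recognizable) (hlet : ∀ a, ∃ y ∈ ρ.subshift, y 0 = a) {g : A → A}
    (hg : ∀ x ∈ ρ.subshift, ρ.firstLetter (x 1) = g (x 0)) :
    ∃ V : ρ.pathSpace → ρ.pathSpace, ρ.IsAdicMap V ∧
      ∃ Ψ : ρ.subshift ≃ₜ ρ.pathSpace, Function.Semiconj Ψ ρ.shift V := by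
  let Ψ : ρ.subshift ≃ₜ ρ.pathSpace := Continuous.homeoOfEquivCompactToT2
    (f := Equiv.ofBijective (toPath hfix hrec)
      ⟨toPath_injective hfix hrec hg, toPath_surjective hfix hrec hlet⟩)
    (continuous_toPath hfix hrec)
  have hshift : Continuous ρ.shift := continuous_seqShift.restrict ρ.mapsTo_seqShift_subshift
  -- Conjugating the shift settles continuity and the values at maximal paths at once.
  refine ⟨Ψ ∘ ρ.shift ∘ Ψ.symm, ⟨by fun_prop, fun p hp => ?_⟩, Ψ, fun x => ?_⟩
  · obtain ⟨x, rfl⟩ := Ψ.surjective p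
    rw [Function.comp_apply, Function.comp_apply, Ψ.symm_apply_apply]
    exact isPathSuccessor_toPath_shift hfix hrec hp
  · simp

end Adic

/-! ### The two-block substitution -/

section TwoBlock

variable {B : Type}

theorem pair_infix_iff {w : List A} {a b : A} :
    [a, b] <:+: w ↔ ∃ d, ∃ h : d + 1 < w.length, w[d] = a ∧ w[d + 1] = b := by
  constructor
  · rintro ⟨s, t, rfl⟩
    exact ⟨s.length, by simp, by simp, by simp⟩
  · rintro ⟨d, h, rfl, rfl⟩
    refine ⟨w.take d, w.drop (d + 2), ?_⟩
    have h1 := List.drop_eq_getElem_cons h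
    have h2 := List.drop_eq_getElem_cons (Nat.lt_of_succ_lt h)
    rw [h1] at h2
    calc w.take d ++ [w[d], w[d + 1]] ++ w.drop (d + 2) = w.take d ++ w.drop d := by
          rw [h2]
          simp
      _ = w := List.take_append_drop d w

/-- The sliding block code with block map `φ` on two letters. -/
def recode (φ : A × A → B) (x : ℕ → A) : ℕ → B := fun m => φ (x m, x (m + 1))

/-- The word of all two-letter blocks of `θ(a) c`, for `q = (a, c)`. -/
def blockWord (θ : Substitution A) (φ : A × A → B) (q : A × A) : List B :=
  List.ofFn fun d : Fin (θ.word q.1).length => φ ((θ.word q.1)[d],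
    if h : (d : ℕ) + 1 < (θ.word q.1).length then (θ.word q.1)[(d : ℕ) + 1] else q.2)

theorem length_blockWord (θ : Substitution A) (φ : A × A → B) (q : A × A) :
    (θ.blockWord φ q).length = (θ.word q.1).length :=
  List.length_ofFn

/-- The substitution on two-letter blocks: the image of the block `ψ b = (a, c)` is the word of all
two-letter blocks of `θ(a) c`. -/
def twoBlock (θ : Substitution A) (φ : A × A → B) (ψ : B → A × A) : Substitution B where
  word b := θ.blockWord φ (ψ b)
  word_ne_nil b h := by
    have h1 := θ.length_blockWord φ (ψ b)
    have h0 := θ.length_word_pos (ψ b).1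
    rw [h, List.length_nil] at h1
    omega

/-- The two-letter blocks in `L`, coded by `φ` with inverse `ψ`, are the blocks that occur in the
image under `θ` of any given letter. -/
structure IsBlockCoding (θ : Substitution A) (L : Set (A × A)) (φ : A × A → B)
    (ψ : B → A × A) : Prop where
  firstLetter_eq : ∀ a, θ.firstLetter a = a
  lastLetter_injective : Function.Injective θ.lastLetter
  two_le_length : ∀ a, 2 ≤ (θ.word a).length
  mem_iff : ∀ a q, q ∈ L ↔ [q.1, q.2] <:+: θ.word a
  lastLetter_mem : ∀ q ∈ L, (θ.lastLetter q.1, q.2) ∈ L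
  decode_mem : ∀ b, ψ b ∈ L
  encode_decode : ∀ b, φ (ψ b) = b
  decode_encode : ∀ q ∈ L, ψ (φ q) = q

namespace IsBlockCoding

variable {θ : Substitution A} {L : Set (A × A)} {φ : A × A → B} {ψ : B → A × A}
  (C : IsBlockCoding θ L φ ψ)

theorem length_word_twoBlock (θ : Substitution A) (φ : A × A → B) (ψ : B → A × A) (b : B) :
    ((θ.twoBlock φ ψ).word b).length = (θ.word (ψ b).1).length :=
  length_blockWord _ _ _

theorem getElem_twoBlock {b : B} {a c : A} (hb : ψ b = (a, c)) {d : ℕ}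
    (hd : d < ((θ.twoBlock φ ψ).word b).length) (h : d < (θ.word a).length) :
    ((θ.twoBlock φ ψ).word b)[d] = φ ((θ.word a)[d],
      if h : d + 1 < (θ.word a).length then (θ.word a)[d + 1] else c) := by
  have hw : (θ.twoBlock φ ψ).word b = θ.blockWord φ (a, c) := congrArg (θ.blockWord φ) hb
  simp [hw, blockWord]

theorem lastLetter_twoBlock (b : B) :
    (θ.twoBlock φ ψ).lastLetter b = φ (θ.lastLetter (ψ b).1, (ψ b).2) := by
  have h := θ.length_word_pos (ψ b).1
  have hl := length_word_twoBlock θ φ ψ b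
  rw [lastLetter, List.getLast_eq_getElem, getElem_twoBlock (ψ := ψ) rfl _ (by omega),
    dif_neg (by omega), lastLetter, List.getLast_eq_getElem]
  simp only [hl]

theorem seqShift_iterate_recode (φ : A × A → B) (x : ℕ → A) (m : ℕ) :
    seqShift^[m] (recode φ x) = recode φ (seqShift^[m] x) := by
  funext i
  simp only [recode, seqShift_iterate_apply, add_right_comm]

include C

theorem firstLetter_decode (a : A) :
    ∃ h : 1 < (θ.word a).length, (a, (θ.word a)[1]) ∈ L := by
  have h := C.two_le_length a
  refine ⟨h, (C.mem_iff a _).2 (pair_infix_iff.2 ⟨0, h, ?_, rfl⟩)⟩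
  rw [← List.head_eq_getElem (θ.word_ne_nil a)]
  exact C.firstLetter_eq a

/-- As `θ(a)` has at least two letters, the first block of `θ(a)c` does not involve `c`. Both the
idempotence of the first-letter map and the injectivity of the path map rest on this. -/
theorem firstLetter_twoBlock {b : B} {a c : A} (hb : ψ b = (a, c))
    (h : 1 < (θ.word a).length) : (θ.twoBlock φ ψ).firstLetter b = φ (a, (θ.word a)[1]) := by
  rw [firstLetter, List.head_eq_getElem, getElem_twoBlock hb _ (by omega), dif_pos (by omega)]
  congr 2
  rw [← List.head_eq_getElem (θ.word_ne_nil _)]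
  exact C.firstLetter_eq _

theorem encode_injOn : Set.InjOn φ L := fun q hq r hr h => by
  rw [← C.decode_encode q hq, ← C.decode_encode r hr, h]

theorem bijOn_encode : Set.BijOn φ L Set.univ :=
  ⟨fun _ _ => Set.mem_univ _, C.encode_injOn, fun b _ =>
    ⟨ψ b, C.decode_mem b, C.encode_decode b⟩⟩

theorem lastLetter_twoBlock_injective : Function.Injective (θ.twoBlock φ ψ).lastLetter := by
  intro b c h
  rw [lastLetter_twoBlock, lastLetter_twoBlock] at h
  have h1 := C.encode_injOn (C.lastLetter_mem _ (C.decode_mem b))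
    (C.lastLetter_mem _ (C.decode_mem c)) h
  rw [Prod.mk.injEq] at h1
  rw [← C.encode_decode b, ← C.encode_decode c, Prod.ext (C.lastLetter_injective h1.1) h1.2]

theorem firstLetter_twoBlock_idempotent (b : B) :
    (θ.twoBlock φ ψ).firstLetter ((θ.twoBlock φ ψ).firstLetter b) =
      (θ.twoBlock φ ψ).firstLetter b := by
  obtain ⟨h, hL⟩ := C.firstLetter_decode (ψ b).1
  rw [C.firstLetter_twoBlock (b := b) rfl h, C.firstLetter_twoBlock (C.decode_encode _ hL) h]

theorem mem_word_twoBlock (b c : B) : c ∈ (θ.twoBlock φ ψ).word b := by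
  obtain ⟨d, hd, h1, h2⟩ := pair_infix_iff.1 ((C.mem_iff (ψ b).1 _).1 (C.decode_mem c))
  have hl := length_word_twoBlock θ φ ψ b
  refine List.mem_iff_getElem.2 ⟨d, by omega, ?_⟩
  rw [getElem_twoBlock (ψ := ψ) rfl _ (by omega), dif_pos hd, h1, h2]
  exact C.encode_decode c

theorem two_le_length_twoBlock (b : B) : 2 ≤ ((θ.twoBlock φ ψ).word b).length := by
  rw [length_word_twoBlock]
  exact C.two_le_length _

/-- Inside an image the blocks match by construction. At its end, the letter following `θ(x i)` is
the first letter of `θ(x (i + 1))`, which is `x (i + 1)` itself. -/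
theorem onSeq_recode {x : ℕ → A} (hx : ∀ m, (x m, x (m + 1)) ∈ L) :
    (θ.twoBlock φ ψ).onSeq (recode φ x) = recode φ (θ.onSeq x) := by
  have hψ : ∀ m, ψ (recode φ x m) = (x m, x (m + 1)) := fun m => C.decode_encode _ (hx m)
  have hlen : ∀ m, ((θ.twoBlock φ ψ).word (recode φ x m)).length = (θ.word (x m)).length :=
    fun m => by rw [length_word_twoBlock, hψ]
  have hcut : ∀ i, (θ.twoBlock φ ψ).cut (recode φ x) i = θ.cut x i := fun i =>
    Finset.sum_congr rfl fun m _ => hlen m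
  funext m
  obtain ⟨i, d, hd, rfl⟩ := θ.exists_eq_cut_add x m
  have h1 := (θ.twoBlock φ ψ).onSeq_cut_add (recode φ x) i d (by rwa [hlen])
  rw [hcut] at h1
  rw [h1, getElem_twoBlock (hψ i) _ hd, recode]
  congr 2
  · exact (θ.onSeq_cut_add x i d hd).symm
  · split_ifs with h
    · exact (θ.onSeq_cut_add x i (d + 1) h).symm
    · have h2 : θ.cut x i + d + 1 = θ.cut x (i + 1) := by
        rw [cut_succ]
        omega
      rw [h2, onSeq_cut, C.firstLetter_eq]

/-- A block inside an image lies in `L` by `mem_iff`. A block across the cut after `θ(u i)` comes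
from the block of `u` at `i`, an earlier position because images have length at least two. -/
theorem blocks_mem_of_onSeq_eq {u : ℕ → A} (hu : θ.onSeq u = u) (m : ℕ) :
    (u m, u (m + 1)) ∈ L := by
  induction m using Nat.strong_induction_on with
  | _ m ih =>
    obtain ⟨i, d, hd, rfl⟩ := θ.exists_eq_cut_add u m
    by_cases h : d + 1 < (θ.word (u i)).length
    · refine (C.mem_iff (u i) _).2 (pair_infix_iff.2 ⟨d, h, ?_, ?_⟩)
      · rw [← θ.onSeq_cut_add u i d hd, hu]
      · rw [← θ.onSeq_cut_add u i (d + 1) h, hu]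
        rfl
    · have h1 : θ.cut u i + d + 1 = θ.cut u (i + 1) := by
        rw [cut_succ]
        omega
      have h2 := θ.two_mul_le_cut u C.two_le_length i
      have h3 := C.two_le_length (u i)
      have h4 := C.lastLetter_mem _ (ih i (by omega))
      rw [← onSeq_cut_succ_sub_one, ← C.firstLetter_eq (u (i + 1)), ← onSeq_cut, hu, ← h1] at h4
      exact h4

theorem powerFixed_eq : θ.powerFixed = {u | θ.onSeq u = u} :=
  powerFixed_eq_of_idempotent C.two_le_length fun a => by rw [C.firstLetter_eq]

theorem powerFixed_twoBlock_eq :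
    (θ.twoBlock φ ψ).powerFixed = {u | (θ.twoBlock φ ψ).onSeq u = u} :=
  powerFixed_eq_of_idempotent C.two_le_length_twoBlock C.firstLetter_twoBlock_idempotent

theorem recode_image_powerFixed : recode φ '' θ.powerFixed = (θ.twoBlock φ ψ).powerFixed := by
  rw [C.powerFixed_eq, C.powerFixed_twoBlock_eq]
  ext v
  constructor
  · rintro ⟨u, hu, rfl⟩
    change _ = _
    rw [C.onSeq_recode (C.blocks_mem_of_onSeq_eq hu), hu]
  · intro hv
    -- The candidate preimage is the fixed point of `θ` starting with the first component of the
    -- block `v 0`.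
    obtain ⟨u, hu, hu0⟩ := exists_onSeq_eq C.two_le_length (C.firstLetter_eq (ψ (v 0)).1)
    refine ⟨u, hu, eq_of_onSeq_eq C.two_le_length_twoBlock ?_ hv ?_⟩
    · rw [C.onSeq_recode (C.blocks_mem_of_onSeq_eq hu), hu]
    · obtain ⟨h, -⟩ := C.firstLetter_decode (ψ (v 0)).1
      have h1 := (θ.twoBlock φ ψ).onSeq_zero v
      rw [hv, C.firstLetter_twoBlock rfl h] at h1
      have h2 := θ.onSeq_lt u 1 (by rwa [hu0])
      simp only [hu, hu0] at h2
      rw [h1, recode, hu0, h2]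

variable [TopologicalSpace A] [DiscreteTopology A]

theorem blocks_mem {x : ℕ → A} (hx : x ∈ θ.subshift) (m : ℕ) : (x m, x (m + 1)) ∈ L := by
  have hcl : IsClosed {x : ℕ → A | (x m, x (m + 1)) ∈ L} :=
    (isClosed_discrete L).preimage
      ((continuous_apply m).prodMk (continuous_apply (m + 1)))
  refine closure_minimal ?_ hcl hx
  rintro _ ⟨u, hu, k, rfl⟩
  rw [C.powerFixed_eq] at hu
  have := C.blocks_mem_of_onSeq_eq hu (m + k)
  change (seqShift^[k] u m, seqShift^[k] u (m + 1)) ∈ L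
  rw [seqShift_iterate_apply, seqShift_iterate_apply]
  rwa [add_right_comm] at this

theorem recode_injOn : Set.InjOn (recode φ) θ.subshift := fun _ hx _ hy h => funext fun m =>
  congrArg Prod.fst (C.encode_injOn (C.blocks_mem hx m) (C.blocks_mem hy m) (congrFun h m))

variable [TopologicalSpace B]

omit C in
theorem continuous_recode (φ : A × A → B) : Continuous (recode φ) :=
  continuous_pi fun m => (continuous_of_discreteTopology (f := φ)).comp
    ((continuous_apply m).prodMk (continuous_apply (m + 1)))

variable [DiscreteTopology B] [Finite A]

theorem recode_image_subshift : recode φ '' θ.subshift = (θ.twoBlock φ ψ).subshift := by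
  rw [subshift, image_closure_of_isCompact isClosed_closure.isCompact
    (continuous_recode φ).continuousOn, subshift, ← C.recode_image_powerFixed]
  congr 1
  ext v
  constructor
  · rintro ⟨_, ⟨u, hu, m, rfl⟩, rfl⟩
    exact ⟨_, ⟨u, hu, rfl⟩, m, (seqShift_iterate_recode φ u m).symm⟩
  · rintro ⟨_, ⟨u, hu, rfl⟩, m, rfl⟩
    exact ⟨_, ⟨u, hu, m, rfl⟩, (seqShift_iterate_recode φ u m).symm⟩

/-- `parsing_unique` needs injective first letters, which the block substitution may lack; the
parsings are therefore decoded and compared for `θ`. -/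
theorem recognizable_twoBlock (hap : θ.Aperiodic) : (θ.twoBlock φ ψ).Recognizable := by
  intro y' hy' z' hz' k l hk hl h
  rw [← C.recode_image_subshift] at hy' hz'
  obtain ⟨y, hy, rfl⟩ := hy'
  obtain ⟨z, hz, rfl⟩ := hz'
  have hθ : ∀ x ∈ θ.subshift, θ.onSeq x ∈ θ.subshift := fun x hx =>
    onSeq_mem_subshift C.powerFixed_eq.subset hx
  rw [length_word_twoBlock, recode, C.decode_encode _ (C.blocks_mem hy 0)] at hk
  rw [length_word_twoBlock, recode, C.decode_encode _ (C.blocks_mem hz 0)] at hl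
  rw [C.onSeq_recode (C.blocks_mem hy), C.onSeq_recode (C.blocks_mem hz),
    seqShift_iterate_recode, seqShift_iterate_recode] at h
  have h' := C.recode_injOn (seqShift_mem_subshift (hθ y hy) k)
    (seqShift_mem_subshift (hθ z hz) l) h
  obtain ⟨rfl, rfl⟩ := parsing_unique
    (fun a b hab => by rwa [C.firstLetter_eq, C.firstLetter_eq] at hab)
    C.lastLetter_injective hk hl h' fun q r hr =>
      hap _ (seqShift_mem_subshift (hθ y hy) q) r hr
  exact ⟨rfl, rfl⟩

variable [Finite B]

theorem exists_adic_twoBlock (hap : θ.Aperiodic) :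
    ∃ V : (θ.twoBlock φ ψ).pathSpace → (θ.twoBlock φ ψ).pathSpace,
      (θ.twoBlock φ ψ).IsAdicMap V ∧
      ∃ Ψ : (θ.twoBlock φ ψ).subshift ≃ₜ (θ.twoBlock φ ψ).pathSpace,
        Function.Semiconj Ψ (θ.twoBlock φ ψ).shift V := by
  refine exists_adic_representation C.powerFixed_twoBlock_eq.subset (C.recognizable_twoBlock hap)
    -- The block after `(a, c)` begins with `c`, so its image starts with the first block of `θ(c)`.
    (fun b => ?_) (g := fun b => φ ((ψ b).2, (θ.word (ψ b).2)[1]'(C.two_le_length _))) ?_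
  · obtain ⟨v, hv, -⟩ := exists_onSeq_eq C.two_le_length_twoBlock
      (C.firstLetter_twoBlock_idempotent b)
    obtain ⟨d, hd, h⟩ := List.mem_iff_getElem.1 (C.mem_word_twoBlock (v 0) b)
    refine ⟨seqShift^[d] v, seqShift_mem_subshift (mem_subshift_of_powerFixed ⟨1, one_pos, hv⟩) d,
      ?_⟩
    rw [seqShift_iterate_apply, zero_add, ← h, ← onSeq_lt, hv]
  · rw [← C.recode_image_subshift]
    rintro _ ⟨x, hx, rfl⟩
    have h1 : ψ (recode φ x 1) = (x 1, x 2) := C.decode_encode _ (C.blocks_mem hx 1)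
    rw [C.firstLetter_twoBlock h1 (C.two_le_length _)]
    simp only [recode, C.decode_encode _ (C.blocks_mem hx 0), zero_add]

/-- The recoding as a homeomorphism of the subshifts. -/
theorem exists_recode_homeomorph : ∃ Φ : θ.subshift ≃ₜ (θ.twoBlock φ ψ).subshift,
    ∀ x, (Φ x).1 = recode φ x.1 := by
  have hm : ∀ x : θ.subshift, recode φ x.1 ∈ (θ.twoBlock φ ψ).subshift := fun x =>
    C.recode_image_subshift ▸ Set.mem_image_of_mem _ x.2
  refine ⟨Continuous.homeoOfEquivCompactToT2 (f := Equiv.ofBijective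
    (fun x => ⟨recode φ x.1, hm x⟩) ⟨fun x y h => ?_, fun v => ?_⟩) ?_, fun x => rfl⟩
  · exact Subtype.ext (C.recode_injOn x.2 y.2 (congrArg Subtype.val h))
  · obtain ⟨x, hx, h⟩ := C.recode_image_subshift.symm.subset v.2
    exact ⟨⟨x, hx⟩, Subtype.ext h⟩
  · exact ((continuous_recode φ).comp continuous_subtype_val).subtype_mk _

end IsBlockCoding

end TwoBlock

/-! ### The language, the choice of power, and preimage counts -/

section Language

variable {τ : Substitution A}

theorem infix_onWord_iterate {v w : List A} (h : v <:+: w) (m : ℕ) :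
    τ.onWord^[m] v <:+: τ.onWord^[m] w := by
  obtain ⟨s, t, rfl⟩ := h
  rw [← onWord_pow, onWord_append, onWord_append]
  exact ⟨_, _, rfl⟩

theorem Primitive.mem_onWord_iterate {k : ℕ} (hk : ∀ a b : A, b ∈ τ.onWord^[k] [a]) {m : ℕ}
    (hm : k ≤ m) (a b : A) : b ∈ τ.onWord^[m] [a] := by
  obtain ⟨j, rfl⟩ := Nat.exists_eq_add_of_le hm
  obtain ⟨c, hc⟩ := List.exists_mem_of_ne_nil _ ((τ.pow j).word_ne_nil a)
  rw [word_pow] at hc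
  rw [Function.iterate_add_apply]
  obtain ⟨s, t, hst⟩ := List.append_of_mem hc
  have : τ.onWord^[k] [c] <:+: τ.onWord^[k] (τ.onWord^[j] [a]) :=
    infix_onWord_iterate ⟨s, t, by rw [hst]; simp⟩ k
  exact this.subset (hk c b)

/-- A word in the language of a primitive substitution occurs in all large powers of all
letters. -/
theorem Primitive.eventually_infix (hτ : τ.Primitive) {w : List A} (hw : w ∈ τ.language) :
    ∀ᶠ m in atTop, ∀ a, w <:+: τ.onWord^[m] [a] := by
  obtain ⟨k, -, hk⟩ := hτ
  obtain ⟨j, b, -, hj⟩ := hw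
  filter_upwards [eventually_ge_atTop (j + k)] with m hm a
  obtain ⟨i, rfl⟩ := Nat.exists_eq_add_of_le hm
  obtain ⟨s, t, hst⟩ := List.append_of_mem
    (Primitive.mem_onWord_iterate hk (Nat.le_add_right k i) a b)
  rw [add_assoc, Function.iterate_add_apply]
  exact hj.trans (infix_onWord_iterate ⟨s, t, by rw [hst]; simp⟩ j)

theorem Primitive.eventually_two_le_length (hτ : τ.Primitive) [Nontrivial A] :
    ∀ᶠ m in atTop, ∀ a, 2 ≤ (τ.onWord^[m] [a]).length := by
  obtain ⟨k, -, hk⟩ := hτ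
  filter_upwards [eventually_ge_atTop k] with m hm a
  obtain ⟨b, c, hbc⟩ := exists_pair_ne A
  have hb := Primitive.mem_onWord_iterate hk hm a b
  have hc := Primitive.mem_onWord_iterate hk hm a c
  by_contra! hlt
  interval_cases h : (τ.onWord^[m] [a]).length
  · rw [List.length_eq_zero_iff.1 h] at hb
    simp at hb
  · obtain ⟨d, hd⟩ := List.length_eq_one_iff.1 h
    rw [hd, List.mem_singleton] at hb hc
    exact hbc (hb.trans hc.symm)

/-- The pair sits across the cut in the image of `ab` under the `p`-th power, since the image of `b`
begins with `b`. -/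
theorem lastLetter_pair_mem_language {p : ℕ} (hF : ∀ a, (τ.pow p).firstLetter a = a) {a b : A}
    (h : [a, b] ∈ τ.language) : [(τ.pow p).lastLetter a, b] ∈ τ.language := by
  obtain ⟨m, c, hm, hc⟩ := h
  refine ⟨p + m, c, by omega, ?_⟩
  rw [Function.iterate_add_apply]
  refine List.IsInfix.trans ?_ (infix_onWord_iterate hc p)
  have h1 : (τ.pow p).word b = b :: ((τ.pow p).word b).tail := by
    have h0 := List.cons_head_tail ((τ.pow p).word_ne_nil b)
    rw [← h0]
    congr 1
    exact hF b
  have h2 := List.dropLast_append_getLast ((τ.pow p).word_ne_nil a)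
  refine ⟨((τ.pow p).word a).dropLast, ((τ.pow p).word b).tail, ?_⟩
  rw [← onWord_pow, show [a, b] = [a] ++ [b] from rfl, onWord_append, onWord_singleton,
    onWord_singleton, h1, ← h2]
  simp [lastLetter]

theorem subshift_pow [TopologicalSpace A] {p : ℕ} (hp : 0 < p) :
    (τ.pow p).subshift = τ.subshift := by
  rw [subshift, subshift, powerFixed_pow τ hp]

theorem Aperiodic.nontrivial [TopologicalSpace A] [Nonempty A] (h : τ.Aperiodic) :
    Nontrivial A := by
  by_contra hA
  rw [not_nontrivial_iff_subsingleton] at hA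
  obtain ⟨a⟩ := ‹Nonempty A›
  exact h (fun _ => a) (mem_subshift_of_powerFixed ⟨1, one_pos, Subsingleton.elim _ _⟩) 1 one_pos
    (Subsingleton.elim _ _)

theorem exists_iterate_eq_self [Finite A] {f : A → A} (hf : Function.Bijective f) :
    ∃ r, 0 < r ∧ ∀ a, f^[r] a = a := by
  obtain ⟨r, hr, h⟩ := isOfFinOrder_iff_pow_eq_one.1
    (isOfFinOrder_of_finite (Equiv.ofBijective f hf))
  refine ⟨r, hr, fun a => ?_⟩
  have := Equiv.congr_fun h a
  rwa [← Equiv.Perm.iterate_eq_pow] at this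

/-- Some power of a primitive aperiodic prefix-permutative substitution fixes all first letters,
and the image of each letter contains all words of length two of the language. -/
theorem exists_pow_covering [TopologicalSpace A] [Finite A] (hprim : τ.Primitive)
    (haper : τ.Aperiodic) (hfirst : τ.PrefixPermutative) :
    ∃ p, 0 < p ∧ (∀ a, (τ.pow p).firstLetter a = a) ∧
      (∀ a, 2 ≤ ((τ.pow p).word a).length) ∧
      ∀ a (q : A × A), [q.1, q.2] ∈ τ.language ↔ [q.1, q.2] <:+: (τ.pow p).word a := by
  obtain ⟨r, hr, hrF⟩ := exists_iterate_eq_self hfirst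
  have h1 : ∀ᶠ m in atTop, ∀ a, 2 ≤ (τ.onWord^[m] [a]).length := by
    cases isEmpty_or_nonempty A
    · exact Eventually.of_forall fun m a => isEmptyElim a
    · have := haper.nontrivial
      exact hprim.eventually_two_le_length
  have h2 : ∀ᶠ m in atTop, ∀ q : A × A, [q.1, q.2] ∈ τ.language →
      ∀ a, [q.1, q.2] <:+: τ.onWord^[m] [a] := by
    refine eventually_all.2 fun q => ?_
    by_cases hq : [q.1, q.2] ∈ τ.language
    · exact (hprim.eventually_infix hq).mono fun m hm _ => hm
    · exact Eventually.of_forall fun m h => absurd h hq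
  obtain ⟨m, hm⟩ := eventually_atTop.1 (h1.and h2)
  -- A multiple of `r` fixes all first letters, and this one is positive and at least `m`.
  obtain ⟨hl, hi⟩ := hm (r * (m + 1)) (by nlinarith)
  have hpos : 0 < r * (m + 1) := Nat.mul_pos hr (Nat.succ_pos m)
  refine ⟨r * (m + 1), hpos, fun a => ?_, fun a => ?_, fun a q => ?_⟩
  · rw [firstLetter_pow, Function.iterate_mul]
    exact Function.iterate_fixed (hrF a) _
  · rw [word_pow]
    exact hl a
  · rw [word_pow]
    exact ⟨fun hq => hi q hq a, fun h => ⟨_, a, hpos, h⟩⟩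

/-- An enumeration of the words of length two in the language. -/
theorem exists_enumeration {n N : ℕ} (τ : Substitution (Fin n))
    (hne : Nonempty (Fin n) → ∃ q : Fin n × Fin n, [q.1, q.2] ∈ τ.language)
    (hN : {w | w ∈ τ.language ∧ w.length = 2}.ncard = N) :
    ∃ (φ : Fin n × Fin n → Fin N) (ψ : Fin N → Fin n × Fin n),
      (∀ b, [(ψ b).1, (ψ b).2] ∈ τ.language) ∧ (∀ b, φ (ψ b) = b) ∧
      ∀ q : Fin n × Fin n, [q.1, q.2] ∈ τ.language → ψ (φ q) = q := by
  classical
  have himage : (fun q : Fin n × Fin n => [q.1, q.2]) '' {q | [q.1, q.2] ∈ τ.language} =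
      {w | w ∈ τ.language ∧ w.length = 2} := by
    ext w
    constructor
    · rintro ⟨q, hq, rfl⟩
      exact ⟨hq, rfl⟩
    · rintro ⟨hw, h2⟩
      obtain ⟨a, b, rfl⟩ := List.length_eq_two.1 h2
      exact ⟨(a, b), hw, rfl⟩
  rw [← himage, Set.ncard_image_of_injective _ (fun q r h => by
    simp only [List.cons.injEq, and_true] at h
    exact Prod.ext h.1 h.2), ← Nat.card_coe_set_eq] at hN
  let e : {q : Fin n × Fin n | [q.1, q.2] ∈ τ.language} ≃ Fin N := Finite.equivFinOfCardEq hN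
  -- Off the language the code is arbitrary; `hne` supplies some value there.
  refine ⟨fun q => if h : [q.1, q.2] ∈ τ.language then e ⟨q, h⟩ else
    e ⟨_, (hne ⟨q.1⟩).choose_spec⟩, fun b => (e.symm b).1, fun b => (e.symm b).2, fun b => ?_,
    fun q hq => ?_⟩
  · have hb : [(e.symm b).1.1, (e.symm b).1.2] ∈ τ.language := (e.symm b).2
    simp only [dif_pos hb]
    exact e.apply_symm_apply b
  · simp only [dif_pos hq, Equiv.symm_apply_apply]

theorem hasPreimageCount_of_semiconj {X Y : Type} {S : X → X} {T : Y → Y} (e : X ≃ Y)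
    (h : Function.Semiconj e S T) {x : X} {k : ℕ} (hk : HasPreimageCount S x k) :
    HasPreimageCount T (e x) k := by
  have : {z | T z = e x} = e '' {z | S z = x} := by
    ext z
    obtain ⟨w, rfl⟩ := e.surjective z
    rw [e.injective.mem_set_image]
    change T (e w) = e x ↔ S w = x
    rw [← h.eq, e.apply_eq_iff_eq]
  rw [HasPreimageCount, this, e.injective.encard_image]
  exact hk

/-- A point of a one-sided subshift over a finite alphabet has finitely many preimages. -/
theorem exists_hasPreimageCount [TopologicalSpace A] [Finite A] (x : τ.subshift) :
    ∃ k, HasPreimageCount τ.shift x k := by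
  have hfin : {z | τ.shift z = x}.Finite := by
    refine Set.Finite.of_finite_image (f := fun z => z.1 0) (Set.toFinite _) ?_
    intro z hz w hw h
    refine Subtype.ext (funext fun m => ?_)
    cases m with
    | zero => exact h
    | succ m => exact congrFun (congrArg Subtype.val (Eq.trans hz hw.symm)) m
  exact ⟨_, hfin.cast_ncard_eq.symm⟩

end Language
end Substitution

/-! ### Assembly of the theorem -/

open Substitution in
theorem theorem5p1 {n N : ℕ} (τ : Substitution (Fin n))
    (hprim : τ.Primitive) (haper : τ.Aperiodic)
    (hfirst : τ.PrefixPermutative) (hlast : τ.SuffixPermutative)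
    (hN : {w | w ∈ τ.language ∧ w.length = 2}.ncard = N) :
    -- the points `x i` fixed by a power of `τ` (by `τ` itself, if each `τ(i)` begins with `i`)
    ∃ (x : Fin n → τ.subshift) (k : Fin n → ℕ),
      (∀ i, (x i).1 0 = i) ∧
      Set.range (fun i => (x i).1) = τ.powerFixed ∧
      ((∀ i, τ.firstLetter i = i) → Set.range (fun i => (x i).1) = {u | τ.onSeq u = u}) ∧
      (∀ i, HasPreimageCount τ.shift (x i) (k i)) ∧
      -- the substitution on `N` letters, with its fixed points `v i`
      ∃ (τ' : Substitution (Fin N)) (v : Fin n → τ'.subshift),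
        τ'.Primitive ∧ τ'.SuffixPermutative ∧
        Function.Injective v ∧
        Set.range (fun i => (v i).1) = {u | τ'.onSeq u = u} ∧
        (∀ i, HasPreimageCount τ'.shift (v i) (k i)) ∧
        -- the 2-block recoding is a conjugacy that takes `x i` to `v i`
        (∃ (φ : Fin n × Fin n → Fin N) (Φ : τ.subshift ≃ₜ τ'.subshift),
          Set.BijOn φ {q | [q.1, q.2] ∈ τ.language} Set.univ ∧
          (∀ (y : τ.subshift) (m : ℕ), (Φ y).1 m = φ (y.1 m, y.1 (m + 1))) ∧
          Function.Semiconj Φ τ.shift τ'.shift ∧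
          ∀ i, Φ (x i) = v i) ∧
        -- the adic representation
        ∃ V : τ'.pathSpace → τ'.pathSpace, τ'.IsAdicMap V ∧
          ∃ Ψ : τ'.subshift ≃ₜ τ'.pathSpace, Function.Semiconj Ψ τ'.shift V := by
  obtain ⟨p, hp, hF, hlen, hL⟩ := exists_pow_covering hprim haper hfirst
  obtain ⟨φ, ψ, hψ, hφψ, hψφ⟩ := exists_enumeration τ (fun ⟨a⟩ =>
    ⟨(((τ.pow p).word a)[0]'(by linarith [hlen a]), ((τ.pow p).word a)[1]'(hlen a)),
      (hL a _).2 (pair_infix_iff.2 ⟨0, hlen a, rfl, rfl⟩)⟩) hN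
  have C : IsBlockCoding (τ.pow p) {q | [q.1, q.2] ∈ τ.language} φ ψ :=
    { firstLetter_eq := hF
      lastLetter_injective := by
        rw [lastLetter_pow]
        exact hlast.1.iterate p
      two_le_length := hlen
      mem_iff := hL
      lastLetter_mem := fun _ hq => lastLetter_pair_mem_language hF hq
      decode_mem := hψ
      encode_decode := hφψ
      decode_encode := hψφ }
  have hX := subshift_pow (τ := τ) hp
  have hpf : τ.powerFixed = {u | (τ.pow p).onSeq u = u} := by
    rw [← powerFixed_pow τ hp, C.powerFixed_eq]
  choose x hx hx0 using fun i => exists_onSeq_eq hlen (hF i)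
  have hxmem : ∀ i, x i ∈ τ.powerFixed := fun i => hpf.symm.subset (hx i)
  have hrange : Set.range x = τ.powerFixed := by
    refine Set.Subset.antisymm (Set.range_subset_iff.2 hxmem) fun u hu => ?_
    exact ⟨u 0, eq_of_onSeq_eq hlen (hx _) (hpf.subset hu) (hx0 _)⟩
  obtain ⟨Φ, hΦ⟩ : ∃ Φ : τ.subshift ≃ₜ ((τ.pow p).twoBlock φ ψ).subshift,
      ∀ y, (Φ y).1 = recode φ y.1 := hX ▸ C.exists_recode_homeomorph
  have hsemi : Function.Semiconj Φ τ.shift ((τ.pow p).twoBlock φ ψ).shift := fun y =>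
    Subtype.ext <| by
      rw [hΦ]
      change recode φ (seqShift y.1) = seqShift (Φ y).1
      rw [hΦ]
      rfl
  let X : Fin n → τ.subshift := fun i => ⟨x i, mem_subshift_of_powerFixed (hxmem i)⟩
  choose k hk using fun i => exists_hasPreimageCount (X i)
  have hXinj : Function.Injective X := fun i j h => by
    rw [← hx0 i, ← hx0 j]
    exact congrFun (congrArg Subtype.val h) 0
  have hvrange : Set.range (fun i => (Φ (X i)).1) =
      {u | ((τ.pow p).twoBlock φ ψ).onSeq u = u} := by
    rw [← C.powerFixed_twoBlock_eq, ← C.recode_image_powerFixed, powerFixed_pow τ hp, ← hrange,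
      ← Set.range_comp]
    exact congrArg Set.range (funext fun i => hΦ (X i))
  refine ⟨X, k, hx0, hrange, fun hid => ?_, hk, (τ.pow p).twoBlock φ ψ, fun i => Φ (X i),
    ⟨1, one_pos, fun b c => ?_⟩, ?_, Φ.injective.comp hXinj, hvrange,
    fun i => hasPreimageCount_of_semiconj Φ.toEquiv hsemi (hk i),
    ⟨φ, Φ, C.bijOn_encode, fun y m => congrFun (hΦ y) m, hsemi, fun _ => rfl⟩,
    C.exists_adic_twoBlock ?_⟩
  · refine hrange.trans (Set.Subset.antisymm ?_ fun u hu => ⟨1, one_pos, hu⟩)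
    intro u hu
    have hu' : (τ.pow p).onSeq u = u := hpf.subset hu
    -- `τ(u)` is fixed by the `p`-th power too and, by `hid`, has the first letter of `u`; hence
    -- `τ(u) = u`.
    refine eq_of_onSeq_eq hlen ?_ hu' (by rw [onSeq_zero, hid])
    rw [onSeq_pow] at hu' ⊢
    rw [← Function.iterate_succ_apply, Function.iterate_succ_apply', hu']
  · rw [Function.iterate_one, onWord_singleton]
    exact C.mem_word_twoBlock b c
  · exact Finite.injective_iff_bijective.1 C.lastLetter_twoBlock_injective
  · intro y hy
    exact haper y (hX ▸ hy)
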